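/- Let $0<\lambda_1<\lambda_2<\cdots<\lambda_n$ be real numbers and let $G_{n,m}(\mathbb{R})=M/GL(m,\mathbb{R})$ be the real Grassmann manifold, where $M$ is the set of real $m\times n$ matrices $X=(x_{\alpha k})$ of rank $m$; write $[X]$ for the class of $X$. For $1\le i_1<\cdots<i_m\le n$, the matrices $X$ whose columns $i_1,\dots,i_m$ form the identity matrix $I$, with the $m\times(n-m)$ matrix $Z$ of the remaining columns as coordinates, give a chart of $G_{n,m}(\mathbb{R})$; let $O_{i_1\cdots i_m}$ be its origin $Z=0$. Let $f:G_{n,m}(\mathbb{R})\to\mathbb{R}$ be the function $$f([X])=\frac{\det\big(\sum_{k=1}^n x_{\alpha k}x_{\beta k}\big)_{1\le\alpha,\beta\le m}}{\det\big(\sum_{k=1}^n \lambda_k^{-2}x_{\alpha k}x_{\beta k}\big)_{1\le\alpha,\beta\le m}},$$ whose critical points are the points $O_{i_1\cdots i_m}$. Equip $G_{n,m}(\mathbb{R})$ with the Riemannian metric given in each of these charts by $g=\mathrm{tr}\big[(I+ZZ^T)^{-1}\,dZ\,(I+Z^TZ)^{-1}\,dZ^T\big]$, let $\nabla f$ be the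 gradient of $f$ with respect to $g$, and let $W^u(p)$ (resp. $W^s(p)$) be the set of points $x$ such that the solution $\varphi:\mathbb{R}\to G_{n,m}(\mathbb{R})$ of $\dot\varphi=-\nabla f(\varphi)$ with $\varphi(0)=x$ tends to $p$ as $t\to-\infty$ (resp. $t\to+\infty$). Let $\mathrm{ind}(p)$ denote the Morse index of $f$ at the critical point $p$. Theorem 1. Let $O_{i_1\cdots i_m}$ and $O_{l_1\cdots l_m}$ be two different critical points of $f$ with $\mathrm{ind}(O_{i_1\cdots i_m})-\mathrm{ind}(O_{l_1\cdots l_m})=1$ and $i_k-l_k>1$ for some $k\in\{1,\dots,m\}$. Then $$W^u(O_{i_1\cdots i_m})\cap W^s(O_{l_1\cdots l_m})=\emptyset,$$ so there is no solution $\varphi:\mathbb{R}\to G_{n,m}(\mathbb{R})$ of $\dot\varphi=-\nabla f(\varphi)$ with $\lim_{t\to-\infty}\varphi(t)=O_{i_1\cdots i_m}$ and $\lim_{t\to+\infty}\varphi(t)=O_{l_1\cdots l_m}$. -/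

import Mathlib

open Filter Topology

noncomputable section

namespace RealGrassmann

/-- The space of real `m × n` matrices of rank `m`; the rows span an `m`-dimensional
subspace of `ℝⁿ`. -/
abbrev Frame (n m : ℕ) : Type := {X : Matrix (Fin m) (Fin n) ℝ // X.rank = m}

/-- Two frames are identified when they differ by the left action of `GL(m, ℝ)`. -/
instance frameSetoid (n m : ℕ) : Setoid (Frame n m) where
  r X Y := ∃ A : GL (Fin m) ℝ, Y.1 = (A : Matrix (Fin m) (Fin m) ℝ) * X.1
  iseqv :=
    { refl := fun X => ⟨1, by simp⟩
      symm := by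
        rintro X Y ⟨A, h⟩
        exact ⟨A⁻¹, by rw [h, ← Matrix.mul_assoc, ← Units.val_mul]; simp⟩
      trans := by
        rintro X Y Z ⟨A, h⟩ ⟨A', h'⟩
        exact ⟨A' * A, by rw [h', h, ← Matrix.mul_assoc, ← Units.val_mul]⟩ }

/-- The real Grassmann manifold `G_{n,m}(ℝ) = M / GL(m, ℝ)`, with the quotient topology. -/
abbrev Gr (n m : ℕ) : Type := Quotient (frameSetoid n m)

/-- The projection `π : M → G_{n,m}(ℝ)`. -/
def proj {n m : ℕ} (X : Frame n m) : Gr n m := Quotient.mk _ X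

/-! ### The standard charts, indexed by `i₁ < ⋯ < i_m` -/

/-- The column indices `k₁ < ⋯ < k_{n-m}` different from `i₁, …, i_m`. -/
abbrev Rest {n m : ℕ} (i : Fin m ↪o Fin n) : Type := {k : Fin n // ∀ a, i a ≠ k}

/-- The coordinate space `ℝ^{m(n-m)}` of the chart indexed by `i`. -/
abbrev Coord {n m : ℕ} (i : Fin m ↪o Fin n) : Type := Fin m → Rest i → ℝ

/-- The matrix whose columns `i₁, …, i_m` form the identity and whose other columns are
given by `Z`. -/
def normalMatrix {n m : ℕ} (i : Fin m ↪o Fin n) (Z : Coord i) : Matrix (Fin m) (Fin n) ℝ :=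
  Matrix.of fun a k => if h : ∀ b, i b ≠ k then Z a ⟨k, h⟩ else if i a = k then 1 else 0

theorem normalMatrix_rank {n m : ℕ} (i : Fin m ↪o Fin n) (Z : Coord i) :
    (normalMatrix i Z).rank = m := by
  have h1 : normalMatrix i Z * (1 : Matrix (Fin n) (Fin n) ℝ).submatrix id i = 1 := by
    ext a b
    simp [normalMatrix, Matrix.mul_apply, Matrix.one_apply, i.injective.eq_iff]
  refine le_antisymm (by simpa using (normalMatrix i Z).rank_le_height) ?_
  have h2 := Matrix.rank_mul_le_left (normalMatrix i Z)
    ((1 : Matrix (Fin n) (Fin n) ℝ).submatrix id i)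
  rw [h1, Matrix.rank_one] at h2
  simpa using h2

/-- The inverse of the chart indexed by `i`. -/
def chartInv {n m : ℕ} (i : Fin m ↪o Fin n) (Z : Coord i) : Gr n m :=
  proj ⟨normalMatrix i Z, normalMatrix_rank i Z⟩

/-- The domain of the chart: the classes of the frames whose columns `i₁, …, i_m` form the
identity matrix. -/
def chartDomain {n m : ℕ} (i : Fin m ↪o Fin n) : Set (Gr n m) :=
  proj '' {X : Frame n m | X.1.submatrix id i = 1}

/-- The chart indexed by `i`. A class in the domain is sent to the entries outside the columns
`i₁, …, i_m` of its representative having the identity in these columns, namely of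
`X_i⁻¹ X` for any representative `X`. The values outside `chartDomain i` are irrelevant. -/
def chart {n m : ℕ} (i : Fin m ↪o Fin n) : Gr n m → Coord i :=
  Quotient.lift (fun (X : Frame n m) a (k : Rest i) => ((X.1.submatrix id i)⁻¹ * X.1) a k.1) (by
    rintro X Y ⟨A, h⟩
    have e : Y.1.submatrix id i = (A : Matrix (Fin m) (Fin m) ℝ) * X.1.submatrix id i := by
      rw [h]; rfl
    have hA : ((A : Matrix (Fin m) (Fin m) ℝ))⁻¹ * (A : Matrix (Fin m) (Fin m) ℝ) = 1 :=
      Matrix.nonsing_inv_mul _ ((Matrix.isUnit_iff_isUnit_det _).1 A.isUnit)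
    have key : (Y.1.submatrix id i)⁻¹ * Y.1 = (X.1.submatrix id i)⁻¹ * X.1 := by
      rw [e, Matrix.mul_inv_rev, h, Matrix.mul_assoc, ← Matrix.mul_assoc _ _ X.1, hA,
        Matrix.one_mul]
    funext a k
    exact congrFun (congrFun key.symm a) k.1)

/-- The point `O_{i₁ ⋯ i_m}`: the origin of the chart indexed by `i`, that is, the coordinate
subspace spanned by `e_{i₁}, …, e_{i_m}`. -/
def origin {n m : ℕ} (i : Fin m ↪o Fin n) : Gr n m := chartInv i 0

/-! ### The Morse function -/

/-- The matrix with rows `ξ̄_α = (x_{α1}/λ₁, …, x_{αn}/λ_n)`. -/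
def scaled {n m : ℕ} (lam : Fin n → ℝ) (X : Matrix (Fin m) (Fin n) ℝ) :
    Matrix (Fin m) (Fin n) ℝ :=
  Matrix.of fun a k => X a k / lam k

/-- The Gram determinant of the rows of a matrix. -/
def gramDet {n m : ℕ} (X : Matrix (Fin m) (Fin n) ℝ) : ℝ :=
  (Matrix.of fun a b => ∑ k, X a k * X b k : Matrix (Fin m) (Fin m) ℝ).det

theorem gramDet_mul {n m : ℕ} (A : Matrix (Fin m) (Fin m) ℝ) (X : Matrix (Fin m) (Fin n) ℝ) :
    gramDet (A * X) = A.det ^ 2 * gramDet X := by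
  have e : ∀ Y : Matrix (Fin m) (Fin n) ℝ, gramDet Y = (Y * Y.transpose).det := fun Y => rfl
  rw [e, e, Matrix.transpose_mul, Matrix.mul_assoc, ← Matrix.mul_assoc X, Matrix.det_mul,
    Matrix.det_mul, Matrix.det_transpose]
  ring

theorem scaled_mul {n m : ℕ} (lam : Fin n → ℝ) (A : Matrix (Fin m) (Fin m) ℝ)
    (X : Matrix (Fin m) (Fin n) ℝ) : scaled lam (A * X) = A * scaled lam X := by
  ext a k
  simp [scaled, Matrix.mul_apply, Finset.sum_div, mul_div_assoc]

/-- The function `f = Δ / Δ̄` on the Grassmann manifold. -/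
def morseFun {n m : ℕ} (lam : Fin n → ℝ) : Gr n m → ℝ :=
  Quotient.lift (fun X : Frame n m => gramDet X.1 / gramDet (scaled lam X.1)) (by
    rintro X Y ⟨A, h⟩
    have hA : (A : Matrix (Fin m) (Fin m) ℝ).det ^ 2 ≠ 0 :=
      pow_ne_zero 2 ((Matrix.isUnit_iff_isUnit_det _).1 A.isUnit).ne_zero
    change gramDet X.1 / gramDet (scaled lam X.1) = gramDet Y.1 / gramDet (scaled lam Y.1)
    rw [h, scaled_mul, gramDet_mul, gramDet_mul, mul_div_mul_left _ _ hA])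

/-- The expression of `f` in the chart indexed by `i`. -/
def localFun {n m : ℕ} (lam : Fin n → ℝ) (i : Fin m ↪o Fin n) (Z : Coord i) : ℝ :=
  morseFun lam (chartInv i Z)

/-- The Hessian of `f` in the chart indexed by `i`, as a bilinear form on coordinate vectors. -/
def localHessian {n m : ℕ} (lam : Fin n → ℝ) (i : Fin m ↪o Fin n) (Z V W : Coord i) : ℝ :=
  fderiv ℝ (fderiv ℝ (localFun lam i)) Z V W

/-- The Morse index of `f` at a critical point `p`: the largest dimension of a subspace on which
the Hessian of `f` at `p`, computed in a chart around `p`, is negative definite. -/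
def morseIndex {n m : ℕ} (lam : Fin n → ℝ) (p : Gr n m) : ℕ :=
  sSup {d | ∃ i : Fin m ↪o Fin n, p ∈ chartDomain i ∧
    ∃ S : Submodule ℝ (Coord i), Module.finrank ℝ S = d ∧
      ∀ V ∈ S, V ≠ 0 → localHessian lam i (chart i p) V V < 0}

/-! ### The Riemannian metric and the negative gradient flow -/

/-- The Riemannian metric `tr[(I + Z Zᵀ)⁻¹ dZ (I + Zᵀ Z)⁻¹ dZᵀ]` in the chart indexed
by `i`. -/
def metric {n m : ℕ} (i : Fin m ↪o Fin n) (Z V W : Coord i) : ℝ :=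
  Matrix.trace ((1 + Matrix.of Z * (Matrix.of Z).transpose)⁻¹ * Matrix.of V *
    (1 + (Matrix.of Z).transpose * Matrix.of Z)⁻¹ * (Matrix.of W).transpose)

/-- `V` is the coordinate vector of the gradient `∇f` at the point with coordinates `Z`:
`g(V, W) = W f` for all tangent vectors `W`. -/
def IsGradientAt {n m : ℕ} (lam : Fin n → ℝ) (i : Fin m ↪o Fin n) (Z V : Coord i) : Prop :=
  ∀ W : Coord i, metric i Z V W = fderiv ℝ (localFun lam i) Z W

/-- `γ : ℝ → G_{n,m}(ℝ)` is a solution of `ẋ = -∇f` defined for all times. -/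
def IsTrajectory {n m : ℕ} (lam : Fin n → ℝ) (γ : ℝ → Gr n m) : Prop :=
  Continuous γ ∧ ∀ (t : ℝ) (i : Fin m ↪o Fin n), γ t ∈ chartDomain i →
    ∃ V : Coord i, IsGradientAt lam i (chart i (γ t)) V ∧
      HasDerivAt (fun s => chart i (γ s)) (-V) t

/-- The stable manifold of `p`: the points whose trajectory tends to `p` as `t → +∞`. -/
def stableManifold {n m : ℕ} (lam : Fin n → ℝ) (p : Gr n m) : Set (Gr n m) :=
  {x | ∃ γ : ℝ → Gr n m, IsTrajectory lam γ ∧ γ 0 = x ∧ Tendsto γ atTop (𝓝 p)}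

/-- The unstable manifold of `p`: the points whose trajectory tends to `p` as `t → -∞`. -/
def unstableManifold {n m : ℕ} (lam : Fin n → ℝ) (p : Gr n m) : Set (Gr n m) :=
  {x | ∃ γ : ℝ → Gr n m, IsTrajectory lam γ ∧ γ 0 = x ∧ Tendsto γ atBot (𝓝 p)}

end RealGrassmann

end

noncomputable section

namespace RealGrassmann

/-! A connecting trajectory can only lower indices: if some point flows from `O_i` (backwards in
time) to `O_l` (forwards), then `l k ≤ i k` for every `k`. The Hessian at `O_i` is diagonal in the
chart centred there, with one negative direction for each pair of a chosen index and a smaller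
unchosen one; so the Morse index is the sum of the `i a - a`. If the indices differ by one, the
nonnegative integers `i a - l a` add up to one, and none of them can exceed one.

The comparison of indices (`le_of_mem_unstable_of_mem_stable`) comes from a monotone inertia. Fix a
threshold and take the diagonal form on `ℝⁿ` equal to `+1` on the coordinates up to the threshold
and `-1` beyond it. Restricted to the moving subspace, it has positive derivative on its kernel
(`derivative_pos_of_mem_ker`), so its eigenvalues can cross zero only upwards and the number of
positive directions never drops (`mem_positiveSet_of_le`). With threshold `i k`, `O_i` has at least
`k + 1` positive directions (`k` counted from zero). If `l k > i k`, then `O_l` has at least `m - k`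
negative ones. Both conditions are open, so they hold along the ends of the trajectories, and
together they would need `m + 1` dimensions in an `m`-dimensional space.

Positivity on the kernel reduces to an inequality for two vectors, `sum_sign_mul_pos`, proved by
applying Cauchy–Schwarz separately on the positive and the negative coordinates. -/

/-! ### The inequality behind the monotonicity. -/

theorem weighted_cauchy_schwarz {n : ℕ} (c v w : Fin n → ℝ) (hc : ∀ k, 0 ≤ c k) :
    (∑ k, c k * v k * w k) ^ 2 ≤ (∑ k, c k * v k ^ 2) * ∑ k, c k * w k ^ 2 := by
  refine Finset.sum_sq_le_sum_mul_sum_of_sq_le_mul _ (fun k _ => ?_) (fun k _ => ?_)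
    (fun k _ => le_of_eq ?_)
  · exact mul_nonneg (hc k) (sq_nonneg _)
  · exact mul_nonneg (hc k) (sq_nonneg _)
  · ring

/-- The infinitesimal form of the monotonicity of the inertia of an indefinite diagonal form. -/
theorem sum_sign_mul_pos {n : ℕ} {D sg : Fin n → ℝ} {d : ℝ} (hd : 0 < d) (hD : ∀ k, 0 < D k)
    (hsg : ∀ k, (sg k = 1 ∧ d ≤ D k) ∨ (sg k = -1 ∧ D k < d)) {v w : Fin n → ℝ} (hv : v ≠ 0)
    (h1 : ∑ k, sg k * v k ^ 2 = 0) (h2 : ∑ k, sg k * v k * w k = 0)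
    (h3 : ∑ k, D k * v k * w k = ∑ k, v k ^ 2) (h4 : ∑ k, D k * w k ^ 2 = ∑ k, v k * w k) :
    0 < ∑ k, sg k * (D k * v k * w k) := by
  -- `p` and `q` are the indicators of the positive and the negative coordinates. By `h1` and `h2`,
  -- each half carries the same share `N` of `∑ v²` and the same share `a` of `∑ v w`.
  obtain ⟨p, hp⟩ : ∃ p : Fin n → ℝ, p = fun k => (1 + sg k) / 2 := ⟨_, rfl⟩
  obtain ⟨q, hq⟩ : ∃ q : Fin n → ℝ, q = fun k => (1 - sg k) / 2 := ⟨_, rfl⟩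
  have hpq : ∀ k, (p k = 1 ∧ q k = 0 ∧ d ≤ D k) ∨ (p k = 0 ∧ q k = 1 ∧ D k < d) := by
    intro k
    rcases hsg k with ⟨h, h'⟩ | ⟨h, h'⟩
    · left; simp [hp, hq, h, h']
    · right; simp [hp, hq, h, h']
  have hp0 : ∀ k, 0 ≤ p k := fun k => by rcases hpq k with h | h <;> simp [h.1]
  have hq0 : ∀ k, 0 ≤ q k := fun k => by rcases hpq k with h | h <;> simp [h.2.1]
  have hsum : ∀ g : Fin n → ℝ, ∑ k, p k * g k = ((∑ k, g k) + ∑ k, sg k * g k) / 2 := by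
    intro g
    rw [← Finset.sum_add_distrib, Finset.sum_div]
    exact Finset.sum_congr rfl fun k _ => by rw [hp]; ring
  have hdif : ∀ g : Fin n → ℝ, ∑ k, q k * g k = ((∑ k, g k) - ∑ k, sg k * g k) / 2 := by
    intro g
    rw [← Finset.sum_sub_distrib, Finset.sum_div]
    exact Finset.sum_congr rfl fun k _ => by rw [hq]; ring
  have hN : 0 < ∑ k, v k ^ 2 := by
    obtain ⟨k, hk⟩ := Function.ne_iff.1 hv
    exact Finset.sum_pos' (fun _ _ => sq_nonneg _)
      ⟨k, Finset.mem_univ _, by have : v k ≠ 0 := hk; positivity⟩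
  -- If the signed sum is nonpositive, the negative half carries at least half of `∑ D v w = 2 N`,
  -- which is `e4`.
  by_contra hneg
  obtain ⟨N, hNdef⟩ : ∃ N, N = (∑ k, v k ^ 2) / 2 := ⟨_, rfl⟩
  obtain ⟨a, ha⟩ : ∃ a, a = (∑ k, v k * w k) / 2 := ⟨_, rfl⟩
  have e1 : ∑ k, p k * v k ^ 2 = N := by rw [hsum (fun k => v k ^ 2), h1, hNdef]; ring
  have e2 : ∑ k, q k * v k ^ 2 = N := by rw [hdif (fun k => v k ^ 2), h1, hNdef]; ring
  have e3 : ∑ k, p k * v k * w k = a := by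
    have := hsum (fun k => v k * w k)
    simp only [← mul_assoc] at this
    rw [this, h2, ha]; ring
  have e4 : N ≤ ∑ k, (q k * D k) * v k * w k := by
    have := hdif (fun k => D k * v k * w k)
    simp only [← mul_assoc] at this
    simp only [← mul_assoc] at hneg
    rw [this, h3, hNdef]; linarith
  have e5 : (∑ k, p k * (D k * w k ^ 2)) + ∑ k, q k * (D k * w k ^ 2) = 2 * a := by
    rw [hsum (fun k => D k * w k ^ 2), hdif (fun k => D k * w k ^ 2), h4, ha]; ring
  have hNpos : 0 < N := by rw [hNdef]; linarith
  have c1 := weighted_cauchy_schwarz p v w hp0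
  have c2 := weighted_cauchy_schwarz (fun k => q k * D k) v w
    (fun k => mul_nonneg (hq0 k) (hD k).le)
  have e6 : d * ∑ k, p k * w k ^ 2 ≤ ∑ k, p k * (D k * w k ^ 2) := by
    rw [Finset.mul_sum]
    refine Finset.sum_le_sum fun k _ => ?_
    rcases hpq k with h | h
    · rw [h.1]; nlinarith [sq_nonneg (w k)]
    · simp [h.1]
  have e7 : ∑ k, q k * D k * v k ^ 2 < d * N := by
    rw [← e2, Finset.mul_sum]
    have hle : ∀ k, q k * D k * v k ^ 2 ≤ d * (q k * v k ^ 2) := by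
      intro k
      rcases hpq k with h | h
      · simp [h.2.1]
      · rw [h.2.1]; nlinarith [sq_nonneg (v k)]
    refine Finset.sum_lt_sum (fun k _ => hle k) ?_
    -- Strictness comes from `D k < d` at a negative coordinate where `v` does not vanish; one
    -- exists because `N > 0`.
    have : ∃ k, 0 < q k * v k ^ 2 := by
      by_contra hcon
      push Not at hcon
      have := Finset.sum_nonpos (s := Finset.univ) fun k _ => hcon k
      rw [e2] at this
      linarith
    obtain ⟨k, hk⟩ := this
    refine ⟨k, Finset.mem_univ _, ?_⟩
    rcases hpq k with h | h
    · simp [h.2.1] at hk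
    · rw [h.2.1] at hk ⊢; nlinarith
  simp only [mul_assoc] at c1 c2 e3 e4 e7
  rw [e1, e3] at c1
  obtain ⟨x, hx⟩ : ∃ x, x = ∑ k, p k * w k ^ 2 := ⟨_, rfl⟩
  obtain ⟨y, hy⟩ : ∃ y, y = ∑ k, q k * (D k * w k ^ 2) := ⟨_, rfl⟩
  rw [← hx] at c1 e6
  rw [← hy] at c2 e5
  have hyd : N ^ 2 ≤ (∑ k, q k * (D k * v k ^ 2)) * y :=
    (pow_le_pow_left₀ hNpos.le e4 2).trans c2
  have hz0 : 0 ≤ ∑ k, q k * (D k * v k ^ 2) :=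
    Finset.sum_nonneg fun k _ => mul_nonneg (hq0 k) (mul_nonneg (hD k).le (sq_nonneg _))
  have hy0 : 0 < y := by
    by_contra h
    nlinarith [pow_pos hNpos 2]
  have hyd' : N < d * y := by
    have h5 : N ^ 2 < d * N * y := hyd.trans_lt (mul_lt_mul_of_pos_right e7 hy0)
    by_contra h
    nlinarith
  have hxy : d * x + y ≤ 2 * a := by linarith
  have h6 : N * (d * x + y) * d ≤ N * (2 * a) * d :=
    mul_le_mul_of_nonneg_right (mul_le_mul_of_nonneg_left hxy hNpos.le) hd.le
  have h7 : d ^ 2 * a ^ 2 ≤ d ^ 2 * (N * x) := mul_le_mul_of_nonneg_left c1 (sq_nonneg d)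
  have h8 : N * N < N * (d * y) := mul_lt_mul_of_pos_left hyd' hNpos
  -- Adding `h7` and `h8` and inserting `h6` gives `d²a² + N² < 2adN`, that is `(da - N)² < 0`.
  nlinarith [sq_nonneg (d * a - N)]

/-! ### Inertia of symmetric forms and its behaviour under perturbation. -/

/-- A positive definite and a negative definite family cannot have too many members together. -/
theorem card_add_card_le_of_definite {m p q : ℕ} (Q : (Fin m → ℝ) → ℝ) (hQ : Q 0 = 0)
    (B : Matrix (Fin p) (Fin m) ℝ) (C : Matrix (Fin q) (Fin m) ℝ)
    (hB : ∀ c, c ≠ 0 → 0 < Q (Matrix.vecMul c B)) (hC : ∀ c, c ≠ 0 → Q (Matrix.vecMul c C) < 0) :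
    p + q ≤ m := by
  let φ : ((Fin p → ℝ) × (Fin q → ℝ)) →ₗ[ℝ] (Fin m → ℝ) :=
    LinearMap.coprod B.vecMulLinear C.vecMulLinear
  have hφ : Function.Injective φ := by
    rw [← LinearMap.ker_eq_bot, LinearMap.ker_eq_bot']
    rintro ⟨c, e⟩ h
    have h' : Matrix.vecMul c B = Matrix.vecMul (-e) C := by
      have h2 : Matrix.vecMul c B + Matrix.vecMul e C = 0 := h
      rw [Matrix.neg_vecMul]
      exact eq_neg_of_add_eq_zero_left h2
    have hB' := hB c
    have hC' := hC (-e)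
    rw [← h'] at hC'
    have hc : c = 0 := by
      by_contra hc
      have he : e = 0 := by
        by_contra he
        exact lt_asymm (hB' hc) (hC' (neg_ne_zero.2 he))
      rw [h', he, neg_zero, Matrix.zero_vecMul, hQ] at hB'
      exact lt_irrefl _ (hB' hc)
    have he : e = 0 := by
      by_contra he
      rw [hc, Matrix.zero_vecMul, hQ] at hC'
      exact lt_irrefl _ (hC' (neg_ne_zero.2 he))
    rw [hc, he]; rfl
  have := LinearMap.finrank_le_finrank_of_injective hφ
  simpa using this

theorem quadratic_smul {q : ℕ} (T : Matrix (Fin q) (Fin q) ℝ) (r : ℝ) (c : Fin q → ℝ) :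
    (r • c) ⬝ᵥ T.mulVec (r • c) = r ^ 2 * (c ⬝ᵥ T.mulVec c) := by
  rw [Matrix.mulVec_smul, smul_dotProduct, dotProduct_smul, smul_eq_mul, smul_eq_mul]
  ring

/-- Homogeneity reduces definiteness to the unit sphere, whose compactness makes the perturbation
arguments below uniform in `c`. -/
theorem quadratic_neg_of_sphere {q : ℕ} (T : Matrix (Fin q) (Fin q) ℝ)
    (h : ∀ c ∈ Metric.sphere (0 : Fin q → ℝ) 1, c ⬝ᵥ T.mulVec c < 0) (c : Fin q → ℝ)
    (hc : c ≠ 0) : c ⬝ᵥ T.mulVec c < 0 := by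
  have hn : 0 < ‖c‖ := norm_pos_iff.2 hc
  have h1 := h (‖c‖⁻¹ • c) (by
    rw [mem_sphere_zero_iff_norm, norm_smul, norm_inv, norm_norm, inv_mul_cancel₀ hn.ne'])
  rw [quadratic_smul] at h1
  by_contra h2
  push Not at h2
  have : 0 ≤ ‖c‖⁻¹ ^ 2 * (c ⬝ᵥ T.mulVec c) := mul_nonneg (sq_nonneg _) h2
  linarith

theorem tendsto_quadratic {α : Type*} {l : Filter α} {q : ℕ}
    {T : α → Matrix (Fin q) (Fin q) ℝ} {T₁ : Matrix (Fin q) (Fin q) ℝ}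
    (hT : ∀ a b, Tendsto (fun t => T t a b) l (𝓝 (T₁ a b))) (c : Fin q → ℝ) :
    Tendsto (fun x : α × (Fin q → ℝ) => x.2 ⬝ᵥ (T x.1).mulVec x.2) (l ×ˢ 𝓝 c)
      (𝓝 (c ⬝ᵥ T₁.mulVec c)) := by
  have hc : ∀ a, Tendsto (fun x : α × (Fin q → ℝ) => x.2 a) (l ×ˢ 𝓝 c) (𝓝 (c a)) := fun a =>
    ((continuous_apply a).tendsto c).comp tendsto_snd
  simp only [dotProduct, Matrix.mulVec]
  exact tendsto_finsetSum _ fun a _ => (hc a).mul (tendsto_finsetSum _ fun b _ =>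
    ((hT a b).comp tendsto_fst).mul (hc b))

/-- A negative definite form stays negative definite under small perturbations. -/
theorem eventually_negative_of_tendsto {α : Type*} {l : Filter α} {q : ℕ}
    {T : α → Matrix (Fin q) (Fin q) ℝ} {T₁ : Matrix (Fin q) (Fin q) ℝ}
    (hT : ∀ a b, Tendsto (fun t => T t a b) l (𝓝 (T₁ a b)))
    (h : ∀ c, c ≠ 0 → c ⬝ᵥ T₁.mulVec c < 0) :
    ∀ᶠ t in l, ∀ c, c ≠ 0 → c ⬝ᵥ (T t).mulVec c < 0 := by
  -- Tube lemma: negativity near each point of the sphere becomes negativity on the whole sphere for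
  -- all parameters far enough along `l`.
  have key := (isCompact_sphere (0 : Fin q → ℝ) 1).mem_prod_nhdsSet_of_forall (l := l)
    (s := {x : α × (Fin q → ℝ) | x.2 ⬝ᵥ (T x.1).mulVec x.2 < 0}) (fun c hc =>
      (tendsto_quadratic hT c).eventually_lt_const (h c (by
        rintro rfl; simp at hc)))
  exact (Filter.Eventually.curry key).mono fun t ht =>
    quadratic_neg_of_sphere _ fun c hc => ht.self_of_nhdsSet c hc

/-- A nonpositive form whose derivative is positive on the null vectors is negative definite
just before. -/
theorem eventually_negative_of_hasDerivAt {q : ℕ} {T : ℝ → Matrix (Fin q) (Fin q) ℝ}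
    {T₁ : Matrix (Fin q) (Fin q) ℝ} {t₀ : ℝ}
    (hT : ∀ a b, HasDerivAt (fun t => T t a b) (T₁ a b) t₀)
    (hle : ∀ c, c ⬝ᵥ (T t₀).mulVec c ≤ 0)
    (hker : ∀ c, c ≠ 0 → c ⬝ᵥ (T t₀).mulVec c = 0 → 0 < c ⬝ᵥ T₁.mulVec c) :
    ∀ᶠ t in 𝓝[<] t₀, ∀ c, c ≠ 0 → c ⬝ᵥ (T t).mulVec c < 0 := by
  have key := (isCompact_sphere (0 : Fin q → ℝ) 1).mem_prod_nhdsSet_of_forall (l := 𝓝[<] t₀)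
    (s := {x : ℝ × (Fin q → ℝ) | x.2 ⬝ᵥ (T x.1).mulVec x.2 < 0}) (fun c hc => by
      have hc0 : c ≠ 0 := by rintro rfl; simp at hc
      rcases (hle c).lt_or_eq with hlt | heq
      · exact (tendsto_quadratic (fun a b =>
          ((hT a b).continuousAt.tendsto.mono_left nhdsWithin_le_nhds)) c).eventually_lt_const hlt
      -- At a null vector, write `T t = T t₀ + (t - t₀) • slope`. The slope form is positive near
      -- `c` and `t - t₀ < 0`, while the first term is nonpositive everywhere.
      · have hs := tendsto_quadratic (l := 𝓝[<] t₀)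
          (T := fun t => Matrix.of fun a b => slope (fun s => T s a b) t₀ t) (T₁ := T₁)
          (fun a b => (hasDerivAt_iff_tendsto_slope.1 (hT a b)).mono_left
            (nhdsWithin_mono _ fun x hx => ne_of_lt hx)) c
        have h1 := hs.eventually_const_lt (hker c hc0 heq)
        have h2 : ∀ᶠ x : ℝ × (Fin q → ℝ) in 𝓝[<] t₀ ×ˢ 𝓝 c, x.1 < t₀ :=
          tendsto_fst.eventually self_mem_nhdsWithin
        filter_upwards [h1, h2] with x hx1 hx2
        have e : T x.1 = T t₀ + (x.1 - t₀) •
            (Matrix.of fun a b => slope (fun s => T s a b) t₀ x.1) := by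
          ext a b
          have : x.1 - t₀ ≠ 0 := by linarith
          simp only [Matrix.add_apply, Matrix.smul_apply, Matrix.of_apply, slope_def_field,
            smul_eq_mul]
          field_simp
          ring
        show x.2 ⬝ᵥ (T x.1).mulVec x.2 < 0
        rw [e, Matrix.add_mulVec, Matrix.smul_mulVec, dotProduct_add, dotProduct_smul,
          smul_eq_mul]
        have := hle x.2
        nlinarith)
  exact (Filter.Eventually.curry key).mono fun t ht =>
    quadratic_neg_of_sphere _ fun c hc => ht.self_of_nhdsSet c hc

theorem quadratic_vecMul {m q : ℕ} (S : Matrix (Fin m) (Fin m) ℝ) (C : Matrix (Fin q) (Fin m) ℝ)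
    (c : Fin q → ℝ) : Matrix.vecMul c C ⬝ᵥ S.mulVec (Matrix.vecMul c C)
      = c ⬝ᵥ (C * S * C.transpose).mulVec c := by
  rw [← Matrix.mulVec_mulVec, ← Matrix.mulVec_mulVec, Matrix.mulVec_transpose,
    Matrix.dotProduct_mulVec c]

/-- The spectral theorem with eigenvectors as rows, so that a family of them is selected by a
`submatrix` on rows. -/
theorem exists_orthonormal_eigenrows {m : ℕ} (S : Matrix (Fin m) (Fin m) ℝ)
    (hS : S.transpose = S) : ∃ (R : Matrix (Fin m) (Fin m) ℝ) (ev : Fin m → ℝ),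
      R * R.transpose = 1 ∧ S * R.transpose = R.transpose * Matrix.diagonal ev := by
  have hH : S.IsHermitian := by
    rw [Matrix.IsHermitian, Matrix.conjTranspose_eq_transpose_of_trivial, hS]
  refine ⟨(hH.eigenvectorUnitary : Matrix (Fin m) (Fin m) ℝ).transpose, hH.eigenvalues, ?_, ?_⟩
  · have := Matrix.UnitaryGroup.star_mul_self hH.eigenvectorUnitary
    rwa [Matrix.star_eq_conjTranspose, Matrix.conjTranspose_eq_transpose_of_trivial] at this
  · rw [Matrix.transpose_transpose]
    have h1 := hH.spectral_theorem
    have := Matrix.UnitaryGroup.star_mul_self hH.eigenvectorUnitary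
    nth_rw 1 [h1]
    simp [Unitary.conjStarAlgAut_apply, Matrix.mul_assoc, this]

/-- Along a path of symmetric forms whose derivative is positive on the kernel, the failure of the
existence of `p` independent positive directions gives many negative directions just before. -/
theorem eventually_negative_directions {m : ℕ} {S : ℝ → Matrix (Fin m) (Fin m) ℝ}
    {S₁ : Matrix (Fin m) (Fin m) ℝ} {t₀ : ℝ} (hsymm : (S t₀).transpose = S t₀)
    (hS : ∀ a b, HasDerivAt (fun t => S t a b) (S₁ a b) t₀)
    (hker : ∀ ξ, ξ ≠ 0 → (S t₀).mulVec ξ = 0 → 0 < ξ ⬝ᵥ S₁.mulVec ξ) (p : ℕ)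
    (hp : ¬ ∃ B : Matrix (Fin p) (Fin m) ℝ, ∀ c, c ≠ 0 →
      0 < Matrix.vecMul c B ⬝ᵥ (S t₀).mulVec (Matrix.vecMul c B)) :
    ∀ᶠ t in 𝓝[<] t₀, ∃ C : Matrix (Fin (m + 1 - p)) (Fin m) ℝ, ∀ c, c ≠ 0 →
      Matrix.vecMul c C ⬝ᵥ (S t).mulVec (Matrix.vecMul c C) < 0 := by
  obtain ⟨R, ev, hR, hev⟩ := exists_orthonormal_eigenrows (S t₀) hsymm
  have hsub : ∀ {q : ℕ} (e : Fin q ↪ Fin m), (R.submatrix e id) * (R.submatrix e id).transpose = 1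
      ∧ S t₀ * (R.submatrix e id).transpose
        = (R.submatrix e id).transpose * Matrix.diagonal (ev ∘ e) := by
    intro q e
    constructor
    · have : (R * R.transpose).submatrix e e = 1 := by
        rw [hR, Matrix.submatrix_one_embedding]
      exact this
    · have : (S t₀ * R.transpose).submatrix id e
          = (R.transpose * Matrix.diagonal ev).submatrix id e := by rw [hev]
      ext a b
      have := congrFun (congrFun this a) b
      rw [Matrix.submatrix_apply, Matrix.submatrix_apply, Matrix.mul_diagonal] at this
      rw [Matrix.mul_diagonal]
      exact this
  have hquad : ∀ {q : ℕ} (e : Fin q ↪ Fin m) (c : Fin q → ℝ),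
      c ⬝ᵥ (R.submatrix e id * S t₀ * (R.submatrix e id).transpose).mulVec c
        = ∑ k, ev (e k) * c k ^ 2 := by
    intro q e c
    rw [Matrix.mul_assoc, (hsub e).2, ← Matrix.mul_assoc, (hsub e).1, Matrix.one_mul, dotProduct]
    refine Finset.sum_congr rfl fun k _ => ?_
    rw [Matrix.mulVec_diagonal, Function.comp_apply]
    ring
  -- Otherwise `p` eigenvectors with positive eigenvalues would contradict `hp`. At least `m + 1 -
  -- p` eigenvalues are therefore nonpositive, and their eigenvectors serve as the fixed family `C`
  -- for earlier times.
  have hlt : Fintype.card {j // 0 < ev j} < p := by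
    by_contra hcon
    obtain ⟨e⟩ := Function.Embedding.nonempty_of_card_le
      (α := Fin p) (β := {j // 0 < ev j}) (by simpa using hcon)
    refine hp ⟨R.submatrix (e.trans (Function.Embedding.subtype _)) id, fun c hc => ?_⟩
    rw [quadratic_vecMul, hquad]
    obtain ⟨k, hk⟩ := Function.ne_iff.1 hc
    have hk' : c k ≠ 0 := hk
    have hpos : ∀ k, 0 < ev ((e.trans (Function.Embedding.subtype _)) k) := fun k => (e k).2
    exact Finset.sum_pos' (fun j _ => mul_nonneg (hpos j).le (sq_nonneg _))
      ⟨k, Finset.mem_univ _, mul_pos (hpos k) (by positivity)⟩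
  have hcard : m + 1 - p ≤ Fintype.card {j // ¬ 0 < ev j} := by
    rw [Fintype.card_subtype_compl, Fintype.card_fin]
    omega
  obtain ⟨e'⟩ := Function.Embedding.nonempty_of_card_le
    (α := Fin (m + 1 - p)) (β := {j // ¬ 0 < ev j}) (by simpa using hcard)
  obtain ⟨e, he⟩ : ∃ e : Fin (m + 1 - p) ↪ Fin m, ∀ k, ev (e k) ≤ 0 :=
    ⟨e'.trans (Function.Embedding.subtype _), fun k => not_lt.1 (e' k).2⟩
  have main := eventually_negative_of_hasDerivAt
    (T := fun t => R.submatrix e id * S t * (R.submatrix e id).transpose)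
    (T₁ := R.submatrix e id * S₁ * (R.submatrix e id).transpose) (t₀ := t₀) ?_ ?_ ?_
  · filter_upwards [main] with t ht
    refine ⟨R.submatrix e id, fun c hc => ?_⟩
    rw [quadratic_vecMul]
    exact ht c hc
  · intro a b
    simp only [Matrix.mul_apply]
    exact HasDerivAt.fun_sum fun k _ => (HasDerivAt.fun_sum fun j _ =>
      (hS j k).const_mul _).mul_const _
  · intro c
    rw [hquad]
    exact Finset.sum_nonpos fun k _ => mul_nonpos_of_nonpos_of_nonneg (he k) (sq_nonneg _)
  · intro c hc h0
    rw [hquad] at h0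
    -- On the span of these eigenvectors a null vector of the form involves only zero eigenvalues,
    -- so it lies in the kernel of `S t₀` and `hker` applies.
    have h1 := (Finset.sum_eq_zero_iff_of_nonpos fun k _ =>
      mul_nonpos_of_nonpos_of_nonneg (he k) (sq_nonneg _)).1 h0
    have h2 : (Matrix.diagonal (ev ∘ e)).mulVec c = 0 := by
      ext k
      rw [Matrix.mulVec_diagonal]
      rcases mul_eq_zero.1 (h1 k (Finset.mem_univ _)) with h | h
      · simp [h]
      · simp [pow_eq_zero_iff] at h
        simp [h]
    rw [← quadratic_vecMul]
    refine hker _ (fun hz => hc ?_) ?_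
    · have : (R.submatrix e id).mulVec (Matrix.vecMul c (R.submatrix e id)) = c := by
        rw [← Matrix.mulVec_transpose, Matrix.mulVec_mulVec, (hsub e).1, Matrix.one_mulVec]
      rw [← this, hz, Matrix.mulVec_zero]
    · rw [← Matrix.mulVec_transpose, Matrix.mulVec_mulVec, (hsub e).2, ← Matrix.mulVec_mulVec, h2,
        Matrix.mulVec_zero]

/-! ### Charts and topology -/

theorem proj_surjective {n m : ℕ} (x : Gr n m) : ∃ X : Frame n m, proj X = x :=
  Quotient.exists_rep x

theorem isOpen_of_preimage_proj {n m : ℕ} {s : Set (Gr n m)}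
    (h : IsOpen {X : Frame n m | proj X ∈ s}) : IsOpen s :=
  isQuotientMap_quotient_mk'.isOpen_preimage.1 h

theorem rank_mul_of_det_ne_zero {n m : ℕ} {A : Matrix (Fin m) (Fin m) ℝ} (hA : A.det ≠ 0)
    (X : Matrix (Fin m) (Fin n) ℝ) : (A * X).rank = X.rank :=
  Matrix.rank_mul_eq_right_of_isUnit_det A X (isUnit_iff_ne_zero.2 hA)

theorem proj_mul {n m : ℕ} {A : Matrix (Fin m) (Fin m) ℝ} (hA : A.det ≠ 0) {X Y : Frame n m}
    (h : Y.1 = A * X.1) : proj Y = proj X :=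
  (Quotient.sound (⟨Matrix.GeneralLinearGroup.mkOfDetNeZero A hA, h⟩ : X ≈ Y)).symm

theorem exists_of_proj_eq {n m : ℕ} {X Y : Frame n m} (h : proj X = proj Y) :
    ∃ A : Matrix (Fin m) (Fin m) ℝ, A.det ≠ 0 ∧ Y.1 = A * X.1 := by
  obtain ⟨A, hA⟩ := Quotient.exact h
  exact ⟨A, ((Matrix.isUnit_iff_isUnit_det _).1 A.isUnit).ne_zero, hA⟩

theorem proj_mem_chartDomain {n m : ℕ} (i : Fin m ↪o Fin n) (X : Frame n m) :
    proj X ∈ chartDomain i ↔ (X.1.submatrix id i).det ≠ 0 := by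
  constructor
  · rintro ⟨Y, hY, h⟩
    obtain ⟨A, hA, e⟩ := exists_of_proj_eq h
    have : X.1.submatrix id i = A * Y.1.submatrix id i := by rw [e]; rfl
    have hY' : Y.1.submatrix id i = 1 := hY
    rw [this, hY', Matrix.mul_one]
    exact hA
  · intro h
    have hd : ((X.1.submatrix id i)⁻¹).det ≠ 0 := by
      rw [Matrix.det_nonsing_inv]
      exact (isUnit_iff_ne_zero.2 h).ringInverse.ne_zero
    refine ⟨⟨(X.1.submatrix id i)⁻¹ * X.1, ?_⟩, ?_, proj_mul hd rfl⟩
    · rw [rank_mul_of_det_ne_zero hd, X.2]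
    · show (X.1.submatrix id i)⁻¹ * X.1.submatrix id i = 1
      exact Matrix.nonsing_inv_mul _ (isUnit_iff_ne_zero.2 h)

theorem isOpen_chartDomain {n m : ℕ} (i : Fin m ↪o Fin n) : IsOpen (chartDomain i) := by
  refine isOpen_of_preimage_proj ?_
  simp only [proj_mem_chartDomain]
  refine isOpen_ne_fun (Continuous.matrix_det ?_) continuous_const
  exact continuous_subtype_val.matrix_submatrix _ _

theorem normalMatrix_submatrix {n m : ℕ} (i : Fin m ↪o Fin n) (Z : Coord i) :
    (normalMatrix i Z).submatrix id i = 1 := by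
  ext a b
  simp [normalMatrix, Matrix.one_apply, i.injective.eq_iff]

theorem normalMatrix_apply_rest {n m : ℕ} (i : Fin m ↪o Fin n) (Z : Coord i) (a : Fin m)
    (k : Rest i) : normalMatrix i Z a k.1 = Z a k := by
  have := k.2
  simp [normalMatrix, this]

theorem chartInv_mem {n m : ℕ} (i : Fin m ↪o Fin n) (Z : Coord i) :
    chartInv i Z ∈ chartDomain i :=
  ⟨_, normalMatrix_submatrix i Z, rfl⟩

theorem chart_chartInv {n m : ℕ} (i : Fin m ↪o Fin n) (Z : Coord i) :
    chart i (chartInv i Z) = Z := by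
  funext a k
  show (((normalMatrix i Z).submatrix id i)⁻¹ * normalMatrix i Z) a k.1 = Z a k
  rw [normalMatrix_submatrix, inv_one, Matrix.one_mul, normalMatrix_apply_rest]

theorem eq_normalMatrix {n m : ℕ} (i : Fin m ↪o Fin n) (X : Matrix (Fin m) (Fin n) ℝ)
    (h : X.submatrix id i = 1) : X = normalMatrix i (fun a k => X a k.1) := by
  ext a k
  by_cases hk : ∀ b, i b ≠ k
  · exact (normalMatrix_apply_rest i (fun a k => X a k.1) a ⟨k, hk⟩).symm
  · push Not at hk
    obtain ⟨b, rfl⟩ := hk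
    have h2 := normalMatrix_submatrix i (fun a k => X a k.1)
    exact congrFun (congrFun (h.trans h2.symm) a) b

theorem chartInv_chart {n m : ℕ} (i : Fin m ↪o Fin n) {x : Gr n m} (hx : x ∈ chartDomain i) :
    chartInv i (chart i x) = x := by
  obtain ⟨X, hX, rfl⟩ := hx
  have h : chart i (proj X) = fun a k => X.1 a k.1 := by
    funext a k
    show ((X.1.submatrix id i)⁻¹ * X.1) a k.1 = _
    have hX' : X.1.submatrix id i = 1 := hX
    rw [hX', inv_one, Matrix.one_mul]
  rw [h]
  refine congrArg proj (Subtype.ext ?_)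
  exact (eq_normalMatrix i X.1 hX).symm

/-- Rank `m` provides `m` independent columns; listing their positions in increasing order gives the
chart. -/
theorem exists_mem_chartDomain {n m : ℕ} (x : Gr n m) :
    ∃ i : Fin m ↪o Fin n, x ∈ chartDomain i := by
  obtain ⟨X, rfl⟩ := proj_surjective x
  obtain ⟨κ, e, he, hspan, hli⟩ := exists_linearIndependent' ℝ X.1.col
  have : Finite κ := Finite.of_injective e he
  have := Fintype.ofFinite κ
  have hcard : Fintype.card κ = m := by
    have h1 := finrank_span_eq_card hli
    rw [hspan, ← Matrix.rank_eq_finrank_span_cols, X.2] at h1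
    exact h1.symm
  have hs : (Finset.univ.image e).card = m := by
    rw [Finset.card_image_of_injective _ he, Finset.card_univ, hcard]
  refine ⟨(Finset.univ.image e).orderEmbOfFin hs, (proj_mem_chartDomain _ _).2 ?_⟩
  have hmem : ∀ a, ∃ k, e k = (Finset.univ.image e).orderEmbOfFin hs a := fun a => by
    obtain ⟨k, -, hk⟩ := Finset.mem_image.1 (Finset.orderEmbOfFin_mem (Finset.univ.image e) hs a)
    exact ⟨k, hk⟩
  choose g hg using hmem
  have hg' : Function.Injective g := fun a b h => by
    have := hg a
    rw [h, hg b] at this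
    exact ((Finset.univ.image e).orderEmbOfFin hs).injective this.symm
  have hli' := hli.comp g hg'
  have hli'' : LinearIndependent ℝ
      (X.1.submatrix id ((Finset.univ.image e).orderEmbOfFin hs)).col := by
    have he' : (X.1.submatrix id ((Finset.univ.image e).orderEmbOfFin hs)).col
        = (X.1.col ∘ e) ∘ g := by
      funext a b
      show X.1 b _ = X.1 b (e (g a))
      rw [hg]
    rw [he']
    exact hli'
  rw [Matrix.linearIndependent_cols_iff_isUnit] at hli''
  exact ((Matrix.isUnit_iff_isUnit_det _).1 hli'').ne_zero

/-! ### Inertia of a diagonal form restricted to a point of the Grassmannian -/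

/-- The Gram matrix of the rows of `X` for the diagonal form with coefficients `sg`. -/
def diagForm {n m : ℕ} (sg : Fin n → ℝ) (X : Matrix (Fin m) (Fin n) ℝ) :
    Matrix (Fin m) (Fin m) ℝ := X * Matrix.diagonal sg * X.transpose

theorem diagForm_apply {n m : ℕ} (sg : Fin n → ℝ) (X : Matrix (Fin m) (Fin n) ℝ) (a b : Fin m) :
    diagForm sg X a b = ∑ k, sg k * X a k * X b k := by
  rw [diagForm, Matrix.mul_apply]
  refine Finset.sum_congr rfl fun k _ => ?_
  rw [Matrix.mul_diagonal, Matrix.transpose_apply]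
  ring

theorem diagForm_transpose {n m : ℕ} (sg : Fin n → ℝ) (X : Matrix (Fin m) (Fin n) ℝ) :
    (diagForm sg X).transpose = diagForm sg X := by
  simp [diagForm, Matrix.mul_assoc]

theorem diagForm_neg {n m : ℕ} (sg : Fin n → ℝ) (X : Matrix (Fin m) (Fin n) ℝ) :
    diagForm (-sg) X = -diagForm sg X := by
  ext a b
  simp [diagForm_apply]

theorem diagForm_mul {n m p : ℕ} (sg : Fin n → ℝ) (A : Matrix (Fin p) (Fin m) ℝ)
    (X : Matrix (Fin m) (Fin n) ℝ) :
    diagForm sg (A * X) = A * diagForm sg X * A.transpose := by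
  simp [diagForm, Matrix.mul_assoc]

/-- The diagonal form with coefficients `sg` is positive definite on some `p`-dimensional
subspace of the row space of `X`. -/
def HasPositive {n m : ℕ} (sg : Fin n → ℝ) (p : ℕ) (X : Matrix (Fin m) (Fin n) ℝ) : Prop :=
  ∃ B : Matrix (Fin p) (Fin m) ℝ, ∀ c, c ≠ 0 → 0 < c ⬝ᵥ (diagForm sg (B * X)).mulVec c

/-- The points of the Grassmannian on which the diagonal form with coefficients `sg` is positive
definite in at least `p` dimensions. -/
def positiveSet {n m : ℕ} (sg : Fin n → ℝ) (p : ℕ) : Set (Gr n m) :=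
  proj '' {X : Frame n m | HasPositive sg p X.1}

theorem proj_mem_positiveSet {n m : ℕ} (sg : Fin n → ℝ) (p : ℕ) (X : Frame n m) :
    proj X ∈ positiveSet sg p ↔ HasPositive sg p X.1 := by
  refine ⟨?_, fun h => ⟨X, h, rfl⟩⟩
  rintro ⟨Y, ⟨B, hB⟩, h⟩
  obtain ⟨A, hA, e⟩ := exists_of_proj_eq h.symm
  refine ⟨B * A, fun c hc => ?_⟩
  rw [Matrix.mul_assoc, ← e]
  exact hB c hc

/-- The coefficients `B` that work for one frame still work for nearby frames, by stability of
definiteness applied to `-sg`. -/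
theorem isOpen_positiveSet {n m : ℕ} (sg : Fin n → ℝ) (p : ℕ) :
    IsOpen (positiveSet sg p : Set (Gr n m)) := by
  refine isOpen_of_preimage_proj (isOpen_iff_mem_nhds.2 fun X hX => ?_)
  obtain ⟨B, hB⟩ := (proj_mem_positiveSet sg p X).1 hX
  have := eventually_negative_of_tendsto (l := 𝓝 X)
    (T := fun Y : Frame n m => diagForm (-sg) (B * Y.1)) (T₁ := diagForm (-sg) (B * X.1)) ?_ ?_
  · filter_upwards [this] with Y hY
    refine (proj_mem_positiveSet sg p Y).2 ⟨B, fun c hc => ?_⟩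
    have h := hY c hc
    rw [diagForm_neg, Matrix.neg_mulVec, dotProduct_neg] at h
    linarith
  · intro a b
    simp only [diagForm_apply, Matrix.mul_apply]
    have hc : ∀ a k, Tendsto (fun Y : Frame n m => Y.1 a k) (𝓝 X) (𝓝 (X.1 a k)) := fun a k =>
      (continuous_subtype_val.matrix_elem a k).tendsto X
    exact tendsto_finsetSum _ fun k _ => (tendsto_const_nhds.mul (tendsto_finsetSum _ fun j _ =>
      tendsto_const_nhds.mul (hc j k))).mul (tendsto_finsetSum _ fun j _ =>
      tendsto_const_nhds.mul (hc j k))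
  · intro c hc
    have h := hB c hc
    rw [diagForm_neg, Matrix.neg_mulVec, dotProduct_neg]
    linarith

theorem add_le_of_mem_positiveSet {n m : ℕ} {sg : Fin n → ℝ} {p q : ℕ} {x : Gr n m}
    (h₁ : x ∈ positiveSet sg p) (h₂ : x ∈ positiveSet (-sg) q) : p + q ≤ m := by
  obtain ⟨X, rfl⟩ := proj_surjective x
  obtain ⟨B, hB⟩ := (proj_mem_positiveSet _ _ X).1 h₁
  obtain ⟨C, hC⟩ := (proj_mem_positiveSet _ _ X).1 h₂
  refine card_add_card_le_of_definite (fun ξ => ξ ⬝ᵥ (diagForm sg X.1).mulVec ξ) (by simp) B C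
    (fun c hc => ?_) (fun c hc => ?_)
  · have h := hB c hc
    rwa [diagForm_mul, ← quadratic_vecMul] at h
  · have h := hC c hc
    rw [diagForm_mul, ← quadratic_vecMul, diagForm_neg, Matrix.neg_mulVec, dotProduct_neg] at h
    linarith

theorem diagForm_normalMatrix_zero {n m : ℕ} (sg : Fin n → ℝ) (i : Fin m ↪o Fin n) :
    diagForm sg (normalMatrix i 0) = Matrix.diagonal (fun a => sg (i a)) := by
  ext a b
  rw [diagForm_apply, Matrix.diagonal_apply]
  have hz : ∀ a k, normalMatrix i 0 a k = if i a = k then 1 else 0 := by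
    intro a k
    by_cases hk : ∀ b, i b ≠ k
    · simp [normalMatrix, hk]
    · simp [normalMatrix, hk]
  by_cases hab : a = b
  · simp [hz, hab]
  · simp [hz, hab, i.injective.eq_iff]

/-- The coordinate subspace `O_i` contains the basis vectors `e_{i a}`. -/
theorem origin_mem_positiveSet {n m p : ℕ} {sg : Fin n → ℝ} (i : Fin m ↪o Fin n)
    (e : Fin p ↪ Fin m) (h : ∀ c, 0 < sg (i (e c))) : origin i ∈ positiveSet sg p := by
  refine (proj_mem_positiveSet _ _ _).2 ⟨(1 : Matrix (Fin m) (Fin m) ℝ).submatrix e id, ?_⟩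
  intro c hc
  have h0 := diagForm_normalMatrix_zero sg i
  have h1 : diagForm sg ((1 : Matrix (Fin m) (Fin m) ℝ).submatrix e id * normalMatrix i 0)
      = Matrix.diagonal (fun c => sg (i (e c))) := by
    rw [diagForm_mul, h0]
    have := Matrix.submatrix_diagonal_embedding (fun a => sg (i a)) e
    rw [show (fun c => sg (i (e c))) = (fun a => sg (i a)) ∘ e from rfl, ← this]
    ext a b
    by_cases hab : a = b
    · simp [Matrix.mul_apply, Matrix.one_apply, Matrix.diagonal_apply, hab]
    · simp [Matrix.mul_apply, Matrix.one_apply, Matrix.diagonal_apply, hab]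
  show 0 < c ⬝ᵥ (diagForm sg (_ * normalMatrix i 0)).mulVec c
  rw [h1, dotProduct]
  obtain ⟨k, hk⟩ := Function.ne_iff.1 hc
  have hk' : c k ≠ 0 := hk
  have e1 : ∀ k, c k * (Matrix.diagonal (fun c => sg (i (e c)))).mulVec c k
      = sg (i (e k)) * c k ^ 2 := fun k => by rw [Matrix.mulVec_diagonal]; ring
  simp only [e1]
  exact Finset.sum_pos' (fun j _ => mul_nonneg (h j).le (sq_nonneg _))
    ⟨k, Finset.mem_univ _, mul_pos (h k) (by positivity)⟩

/-! ### Derivatives -/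

/-- Jacobi's formula, by differentiating the Leibniz expansion and recognising Cramer's rule column
by column. -/
theorem hasDerivAt_det {q : ℕ} {M : ℝ → Matrix (Fin q) (Fin q) ℝ} {M' : Matrix (Fin q) (Fin q) ℝ}
    {t : ℝ} (h : ∀ a b, HasDerivAt (fun s => M s a b) (M' a b) t) :
    HasDerivAt (fun s => (M s).det) ((M t).adjugate * M').trace t := by
  have e : ((M t).adjugate * M').trace
      = ∑ σ : Equiv.Perm (Fin q), (Equiv.Perm.sign σ : ℝ) *
        ∑ b, (∏ c ∈ Finset.univ.erase b, M t (σ c) c) • M' (σ b) b := by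
    have h1 : ∀ b, ((M t).adjugate * M') b b = ((M t).updateCol b (fun a => M' a b)).det := by
      intro b
      rw [← Matrix.cramer_apply, Matrix.cramer_eq_adjugate_mulVec]
      rfl
    rw [Matrix.trace]
    simp only [Matrix.diag_apply, h1, Matrix.det_apply', Finset.mul_sum]
    rw [Finset.sum_comm]
    refine Finset.sum_congr rfl fun σ _ => Finset.sum_congr rfl fun b _ => ?_
    rw [← Finset.mul_prod_erase Finset.univ _ (Finset.mem_univ b), Matrix.updateCol_self,
      smul_eq_mul]
    rw [Finset.prod_congr rfl fun c hc => Matrix.updateCol_ne (Finset.ne_of_mem_erase hc)]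
    ring
  rw [e]
  simp only [Matrix.det_apply']
  exact HasDerivAt.fun_sum fun σ _ =>
    (HasDerivAt.fun_finsetProd fun b _ => h (σ b) b).const_mul _

theorem hasDerivAt_diagForm {n m : ℕ} (sg : Fin n → ℝ) {X : ℝ → Matrix (Fin m) (Fin n) ℝ}
    {X' : Matrix (Fin m) (Fin n) ℝ} {t : ℝ} (h : ∀ a k, HasDerivAt (fun s => X s a k) (X' a k) t)
    (a b : Fin m) : HasDerivAt (fun s => diagForm sg (X s) a b)
      ((X' * Matrix.diagonal sg * (X t).transpose + X t * Matrix.diagonal sg * X'.transpose) a b)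
      t := by
  have e : (X' * Matrix.diagonal sg * (X t).transpose
      + X t * Matrix.diagonal sg * X'.transpose) a b
      = ∑ k, (sg k * X' a k * X t b k + sg k * X t a k * X' b k) := by
    rw [Matrix.add_apply, Matrix.mul_apply, Matrix.mul_apply, ← Finset.sum_add_distrib]
    refine Finset.sum_congr rfl fun k _ => ?_
    rw [Matrix.mul_diagonal, Matrix.transpose_apply, Matrix.mul_diagonal, Matrix.transpose_apply]
    ring
  rw [e]
  simp only [diagForm_apply]
  exact HasDerivAt.fun_sum fun k _ => ((h a k).const_mul (sg k)).mul (h b k)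

/-- The matrix equal to `W` outside the columns `i₁, …, i_m` and zero in these columns. -/
def pad {n m : ℕ} (i : Fin m ↪o Fin n) (W : Coord i) : Matrix (Fin m) (Fin n) ℝ :=
  Matrix.of fun a k => if h : ∀ b, i b ≠ k then W a ⟨k, h⟩ else 0

theorem pad_apply_rest {n m : ℕ} (i : Fin m ↪o Fin n) (W : Coord i) (a : Fin m) (k : Rest i) :
    pad i W a k.1 = W a k := by
  have := k.2
  simp [pad, this]

theorem pad_apply_range {n m : ℕ} (i : Fin m ↪o Fin n) (W : Coord i) (a b : Fin m) :
    pad i W a (i b) = 0 := by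
  simp [pad]

theorem hasDerivAt_normalMatrix {n m : ℕ} (i : Fin m ↪o Fin n) {Z : ℝ → Coord i} {W : Coord i}
    {t : ℝ} (h : HasDerivAt Z W t) (a : Fin m) (k : Fin n) :
    HasDerivAt (fun s => normalMatrix i (Z s) a k) (pad i W a k) t := by
  by_cases hk : ∀ b, i b ≠ k
  · have h1 := hasDerivAt_pi.1 (hasDerivAt_pi.1 h a) ⟨k, hk⟩
    simpa [normalMatrix, pad, hk] using h1
  · simpa [normalMatrix, pad, hk] using hasDerivAt_const t (if i a = k then (1 : ℝ) else 0)

theorem sum_split {M : Type*} [AddCommMonoid M] {n m : ℕ} (i : Fin m ↪o Fin n) (g : Fin n → M) :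
    ∑ k, g k = ∑ a, g (i a) + ∑ k : Rest i, g k.1 := by
  have hb : Function.Bijective (Sum.elim i Subtype.val : Fin m ⊕ Rest i → Fin n) := by
    constructor
    · rintro (a | a) (b | b) h
      · exact congrArg _ (i.injective h)
      · exact absurd h (b.2 a)
      · exact absurd h.symm (a.2 b)
      · exact congrArg _ (Subtype.ext h)
    · intro k
      by_cases hk : ∀ b, i b ≠ k
      · exact ⟨Sum.inr ⟨k, hk⟩, rfl⟩
      · push Not at hk
        exact ⟨Sum.inl hk.choose, hk.choose_spec⟩
  rw [← (Equiv.ofBijective _ hb).sum_comp, Fintype.sum_sum_type]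
  rfl

theorem mul_split {n m : ℕ} (i : Fin m ↪o Fin n) {κ ι : Type*} (P : Matrix κ (Fin n) ℝ)
    (Y : Matrix (Fin n) ι ℝ) : P * Y = P.submatrix id i * Y.submatrix i id
      + P.submatrix id (Subtype.val : Rest i → Fin n) * Y.submatrix Subtype.val id := by
  ext a b
  rw [Matrix.add_apply, Matrix.mul_apply, sum_split i]
  rfl

theorem mulVec_split {n m : ℕ} (i : Fin m ↪o Fin n) {κ : Type*} (P : Matrix κ (Fin n) ℝ)
    (y : Fin n → ℝ) : P.mulVec y = (P.submatrix id i).mulVec (y ∘ i)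
      + (P.submatrix id (Subtype.val : Rest i → Fin n)).mulVec (y ∘ Subtype.val) := by
  ext a
  rw [Pi.add_apply, Matrix.mulVec, dotProduct, sum_split i]
  rfl

theorem normalMatrix_submatrix_rest {n m : ℕ} (i : Fin m ↪o Fin n) (Z : Coord i) :
    (normalMatrix i Z).submatrix id (Subtype.val : Rest i → Fin n) = Matrix.of Z := by
  ext a k
  exact normalMatrix_apply_rest i Z a k

theorem pad_submatrix {n m : ℕ} (i : Fin m ↪o Fin n) (W : Coord i) :
    (pad i W).submatrix id i = 0 := by
  ext a b
  exact pad_apply_range i W a b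

theorem pad_submatrix_rest {n m : ℕ} (i : Fin m ↪o Fin n) (W : Coord i) :
    (pad i W).submatrix id (Subtype.val : Rest i → Fin n) = Matrix.of W := by
  ext a k
  exact pad_apply_rest i W a k

/-! ### The function in a chart -/

/-- The weights `λ_k⁻²`. -/
def weight {n : ℕ} (lam : Fin n → ℝ) (k : Fin n) : ℝ := (lam k ^ 2)⁻¹

theorem localFun_eq {n m : ℕ} (lam : Fin n → ℝ) (i : Fin m ↪o Fin n) (Z : Coord i) :
    localFun lam i Z = (diagForm (fun _ => 1) (normalMatrix i Z)).det
      / (diagForm (weight lam) (normalMatrix i Z)).det := by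
  show gramDet _ / gramDet (scaled lam _) = _
  rw [gramDet, gramDet]
  congr 2
  · ext a b
    simp [diagForm_apply]
  · ext a b
    simp only [diagForm_apply, scaled, Matrix.of_apply, weight]
    refine Finset.sum_congr rfl fun k _ => ?_
    rw [div_mul_div_comm, div_eq_inv_mul, ← pow_two]
    ring

theorem diagForm_posDef {n m : ℕ} {D : Fin n → ℝ} (hD : ∀ k, 0 < D k) (i : Fin m ↪o Fin n)
    (Z : Coord i) : (diagForm D (normalMatrix i Z)).PosDef := by
  refine Matrix.PosDef.of_dotProduct_mulVec_pos ?_ fun c hc => ?_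
  · rw [Matrix.IsHermitian, Matrix.conjTranspose_eq_transpose_of_trivial, diagForm_transpose]
  · have e : star c ⬝ᵥ (diagForm D (normalMatrix i Z)).mulVec c
        = ∑ k, D k * (Matrix.vecMul c (normalMatrix i Z) k) ^ 2 := by
      rw [star_trivial, diagForm, ← quadratic_vecMul, dotProduct]
      refine Finset.sum_congr rfl fun k _ => ?_
      rw [Matrix.mulVec_diagonal]
      ring
    rw [e]
    obtain ⟨a, ha⟩ := Function.ne_iff.1 hc
    refine Finset.sum_pos' (fun k _ => mul_nonneg (hD k).le (sq_nonneg _))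
      ⟨i a, Finset.mem_univ _, mul_pos (hD _) ?_⟩
    have : Matrix.vecMul c (normalMatrix i Z) (i a) = c a := by
      have h1 : Matrix.vecMul c ((normalMatrix i Z).submatrix id i) a = c a := by
        rw [normalMatrix_submatrix, Matrix.vecMul_one]
      exact h1
    rw [this]
    have h2 : c a ≠ 0 := ha
    positivity

theorem weight_pos {n : ℕ} {lam : Fin n → ℝ} (hpos : ∀ j, 0 < lam j) (k : Fin n) :
    0 < weight lam k := inv_pos.2 (pow_pos (hpos k) 2)

theorem localFun_pos {n m : ℕ} {lam : Fin n → ℝ} (hpos : ∀ j, 0 < lam j) (i : Fin m ↪o Fin n)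
    (Z : Coord i) : 0 < localFun lam i Z := by
  rw [localFun_eq]
  exact div_pos (diagForm_posDef (fun _ => one_pos) i Z).det_pos
    (diagForm_posDef (weight_pos hpos) i Z).det_pos

theorem contDiff_det_diagForm {n m : ℕ} (D : Fin n → ℝ) (i : Fin m ↪o Fin n) {r : WithTop ℕ∞} :
    ContDiff ℝ r (fun Z : Coord i => (diagForm D (normalMatrix i Z)).det) := by
  have h : ∀ a k, ContDiff ℝ r (fun Z : Coord i => normalMatrix i Z a k) := by
    intro a k
    by_cases hk : ∀ b, i b ≠ k
    · have : (fun Z : Coord i => normalMatrix i Z a k) = fun Z => Z a ⟨k, hk⟩ := by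
        funext Z; simp [normalMatrix, hk]
      rw [this]
      exact contDiff_apply_apply ℝ ℝ a (⟨k, hk⟩ : Rest i)
    · have : (fun Z : Coord i => normalMatrix i Z a k) = fun Z => if i a = k then 1 else 0 := by
        funext Z; simp [normalMatrix, hk]
      rw [this]
      exact contDiff_const
  simp only [Matrix.det_apply', diagForm_apply]
  exact ContDiff.sum fun σ _ => contDiff_const.mul (contDiff_prod fun b _ => ContDiff.sum fun k _ =>
    (contDiff_const.mul (h _ k)).mul (h _ k))

theorem contDiff_localFun {n m : ℕ} {lam : Fin n → ℝ} (hpos : ∀ j, 0 < lam j)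
    (i : Fin m ↪o Fin n) {r : WithTop ℕ∞} : ContDiff ℝ r (localFun lam i) := by
  rw [show localFun lam i = _ from funext (localFun_eq lam i)]
  exact (contDiff_det_diagForm _ i).div (contDiff_det_diagForm _ i)
    fun Z => (diagForm_posDef (weight_pos hpos) i Z).det_pos.ne'

theorem fderiv_localFun_eq_of_hasDerivAt {n m : ℕ} {lam : Fin n → ℝ} (hpos : ∀ j, 0 < lam j)
    (i : Fin m ↪o Fin n) (Z W : Coord i) {d : ℝ}
    (h : HasDerivAt (fun t : ℝ => localFun lam i (Z + t • W)) d 0) :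
    fderiv ℝ (localFun lam i) Z W = d := by
  have h1 : HasDerivAt (fun t : ℝ => Z + t • W) W 0 := by
    simpa using ((hasDerivAt_id (0 : ℝ)).smul_const W).const_add Z
  have h2 : HasFDerivAt (localFun lam i) (fderiv ℝ (localFun lam i) Z)
      ((fun t : ℝ => Z + t • W) 0) := by
    simp only [zero_smul, add_zero]
    exact ((contDiff_localFun hpos i (r := 1)).differentiable one_ne_zero Z).hasFDerivAt
  have h3 := h2.comp_hasDerivAt 0 h1
  exact h3.unique h

/-! ### The differential and the gradient of the function, and the derivative of the form along the
flow. -/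

theorem trace_adjugate_mul {m : ℕ} {G : Matrix (Fin m) (Fin m) ℝ} (hG : G.det ≠ 0)
    (A : Matrix (Fin m) (Fin m) ℝ) : (G.adjugate * A).trace = G.det * (G⁻¹ * A).trace := by
  rw [Matrix.inv_def, Ring.inverse_eq_inv', Matrix.smul_mul, Matrix.trace_smul, smul_eq_mul,
    mul_inv_cancel_left₀ hG]

theorem trace_inv_mul_symm {n m : ℕ} {G : Matrix (Fin m) (Fin m) ℝ} (hG : G.transpose = G)
    (X W : Matrix (Fin m) (Fin n) ℝ) (D : Fin n → ℝ) :
    (G⁻¹ * (W * Matrix.diagonal D * X.transpose + X * Matrix.diagonal D * W.transpose)).trace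
      = 2 * (G⁻¹ * X * Matrix.diagonal D * W.transpose).trace := by
  have h : (G⁻¹ * (W * Matrix.diagonal D * X.transpose)).trace
      = (G⁻¹ * X * Matrix.diagonal D * W.transpose).trace := by
    rw [← Matrix.trace_transpose, Matrix.transpose_mul, Matrix.transpose_nonsing_inv, hG,
      Matrix.trace_mul_comm]
    simp [Matrix.mul_assoc]
  rw [Matrix.mul_add, Matrix.trace_add, h]
  simp only [Matrix.mul_assoc]
  ring

/-- The matrix `G⁻¹ X - H⁻¹ X D` representing half the differential of `log f`. -/
def logDeriv {n m : ℕ} (lam : Fin n → ℝ) (X : Matrix (Fin m) (Fin n) ℝ) :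
    Matrix (Fin m) (Fin n) ℝ :=
  (diagForm (fun _ => 1) X)⁻¹ * X
    - (diagForm (weight lam) X)⁻¹ * X * Matrix.diagonal (weight lam)

theorem fderiv_localFun {n m : ℕ} {lam : Fin n → ℝ} (hpos : ∀ j, 0 < lam j)
    (i : Fin m ↪o Fin n) (Z W : Coord i) : fderiv ℝ (localFun lam i) Z W
      = 2 * localFun lam i Z * (logDeriv lam (normalMatrix i Z) * (pad i W).transpose).trace := by
  apply fderiv_localFun_eq_of_hasDerivAt hpos
  have h1 : HasDerivAt (fun t : ℝ => Z + t • W) W 0 := by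
    simpa using ((hasDerivAt_id (0 : ℝ)).smul_const W).const_add Z
  have hd : ∀ D : Fin n → ℝ, HasDerivAt
      (fun t : ℝ => (diagForm D (normalMatrix i (Z + t • W))).det) _ 0 := fun D =>
    hasDerivAt_det (hasDerivAt_diagForm D (hasDerivAt_normalMatrix i h1))
  have hG := (diagForm_posDef (D := fun _ => 1) (fun _ => one_pos) i Z).det_pos.ne'
  have hH := (diagForm_posDef (weight_pos hpos) i Z).det_pos.ne'
  have h2 := (hd fun _ => 1).div (hd (weight lam)) (by simpa using hH)
  rw [show localFun lam i = _ from funext (localFun_eq lam i)]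
  refine h2.congr_deriv ?_
  simp only [zero_smul, add_zero]
  rw [trace_adjugate_mul hG, trace_adjugate_mul hH, trace_inv_mul_symm (diagForm_transpose _ _),
    trace_inv_mul_symm (diagForm_transpose _ _), logDeriv, Matrix.sub_mul, Matrix.trace_sub]
  have h3 : Matrix.diagonal (fun _ : Fin n => (1 : ℝ)) = 1 := Matrix.diagonal_one
  rw [h3, Matrix.mul_one]
  field_simp

/-- Both terms contribute the identity (`G⁻¹G` and `H⁻¹H`) and cancel. This is the infinitesimal
invariance of `f` under `GL(m, ℝ)`. -/
theorem logDeriv_mul_transpose {n m : ℕ} {lam : Fin n → ℝ} (hpos : ∀ j, 0 < lam j)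
    (i : Fin m ↪o Fin n) (Z : Coord i) :
    logDeriv lam (normalMatrix i Z) * (normalMatrix i Z).transpose = 0 := by
  have hG := (diagForm_posDef (D := fun _ => 1) (fun _ => one_pos) i Z).det_pos.ne'
  have hH := (diagForm_posDef (weight_pos hpos) i Z).det_pos.ne'
  have h1 := Matrix.nonsing_inv_mul _ (isUnit_iff_ne_zero.2 hG)
  have h2 := Matrix.nonsing_inv_mul _ (isUnit_iff_ne_zero.2 hH)
  have h3 : Matrix.diagonal (fun _ : Fin n => (1 : ℝ)) = 1 := Matrix.diagonal_one
  rw [logDeriv, Matrix.sub_mul, sub_eq_zero]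
  nth_rw 2 [diagForm] at h1
  nth_rw 2 [diagForm] at h2
  rw [h3, Matrix.mul_one] at h1
  rw [Matrix.mul_assoc, h1, ← h2]
  simp only [Matrix.mul_assoc]

/-- Nondegeneracy of the trace pairing turns `g(V, W) = df(W)` into a matrix equation, solved by
cancelling the two inverse factors of the metric. -/
theorem gradient_eq {n m : ℕ} {lam : Fin n → ℝ} (hpos : ∀ j, 0 < lam j)
    {i : Fin m ↪o Fin n} {Z V : Coord i} (hV : IsGradientAt lam i Z V) :
    Matrix.of V = (2 * localFun lam i Z) • (diagForm (fun _ => 1) (normalMatrix i Z)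
      * (logDeriv lam (normalMatrix i Z)).submatrix id (Subtype.val : Rest i → Fin n)
      * (1 + (Matrix.of Z).transpose * Matrix.of Z)) := by
  have hA : 1 + Matrix.of Z * (Matrix.of Z).transpose
      = diagForm (fun _ => 1) (normalMatrix i Z) := by
    have h3 : Matrix.diagonal (fun _ : Fin n => (1 : ℝ)) = 1 := Matrix.diagonal_one
    rw [diagForm, h3, Matrix.mul_one, mul_split i, ← Matrix.transpose_submatrix,
      ← Matrix.transpose_submatrix, normalMatrix_submatrix, normalMatrix_submatrix_rest,
      Matrix.transpose_one, Matrix.mul_one]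
    rfl
  have hG := (diagForm_posDef (D := fun _ => 1) (fun _ => one_pos) i Z).det_pos.ne'
  have hB : (1 + (Matrix.of Z).transpose * Matrix.of Z).det ≠ 0 := by
    rw [Matrix.det_one_add_mul_comm, hA]
    exact hG
  have key : (diagForm (fun _ => 1) (normalMatrix i Z))⁻¹ * Matrix.of V
      * (1 + (Matrix.of Z).transpose * Matrix.of Z)⁻¹ = (2 * localFun lam i Z) •
        (logDeriv lam (normalMatrix i Z)).submatrix id (Subtype.val : Rest i → Fin n) := by
    refine Matrix.ext_iff_trace_mul_right.2 fun W => ?_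
    have h := hV (fun a k => W k a)
    rw [fderiv_localFun hpos, metric, hA] at h
    rw [Matrix.smul_mul, Matrix.trace_smul, smul_eq_mul]
    refine Eq.trans h ?_
    rw [mul_split i, ← Matrix.transpose_submatrix, ← Matrix.transpose_submatrix, pad_submatrix,
      pad_submatrix_rest, Matrix.transpose_zero, Matrix.mul_zero, zero_add]
    rfl
  have e1 := Matrix.mul_nonsing_inv _ (isUnit_iff_ne_zero.2 hG)
  have e2 := Matrix.nonsing_inv_mul _ (isUnit_iff_ne_zero.2 hB)
  calc Matrix.of V = (diagForm (fun _ => 1) (normalMatrix i Z)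
        * (diagForm (fun _ => 1) (normalMatrix i Z))⁻¹) * Matrix.of V
        * ((1 + (Matrix.of Z).transpose * Matrix.of Z)⁻¹
        * (1 + (Matrix.of Z).transpose * Matrix.of Z)) := by
          rw [e1, e2, Matrix.one_mul, Matrix.mul_one]
    _ = diagForm (fun _ => 1) (normalMatrix i Z)
        * ((diagForm (fun _ => 1) (normalMatrix i Z))⁻¹ * Matrix.of V
        * (1 + (Matrix.of Z).transpose * Matrix.of Z)⁻¹)
        * (1 + (Matrix.of Z).transpose * Matrix.of Z) := by
          simp only [Matrix.mul_assoc]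
    _ = _ := by
          rw [key, Matrix.mul_smul, Matrix.smul_mul]

/-- The gradient paired with a covector vanishing on the row space. -/
theorem pad_gradient_mulVec {n m : ℕ} {lam : Fin n → ℝ} (hpos : ∀ j, 0 < lam j)
    {i : Fin m ↪o Fin n} {Z V : Coord i} (hV : IsGradientAt lam i Z V) {y : Fin n → ℝ}
    (hy : (normalMatrix i Z).mulVec y = 0) : (pad i V).mulVec y = (2 * localFun lam i Z) •
      (diagForm (fun _ => 1) (normalMatrix i Z) * logDeriv lam (normalMatrix i Z)).mulVec y := by
  have hM := logDeriv_mul_transpose hpos i Z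
  rw [mul_split i, ← Matrix.transpose_submatrix, ← Matrix.transpose_submatrix,
    normalMatrix_submatrix, normalMatrix_submatrix_rest, Matrix.transpose_one,
    Matrix.mul_one] at hM
  rw [mulVec_split i, normalMatrix_submatrix, normalMatrix_submatrix_rest,
    Matrix.one_mulVec] at hy
  rw [mulVec_split i, pad_submatrix, pad_submatrix_rest, Matrix.zero_mulVec, zero_add,
    gradient_eq hpos hV, Matrix.smul_mulVec, ← Matrix.mulVec_mulVec, ← Matrix.mulVec_mulVec,
    ← Matrix.mulVec_mulVec, mulVec_split i (logDeriv lam _)]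
  congr 2
  -- `hy` turns `Z` applied to the remaining entries of `y` into minus its entries at `i`, and `hM`
  -- turns `Zᵀ` into minus the block of `logDeriv` at `i`. The metric factor `1 + ZᵀZ` thus just
  -- restores the missing columns of `logDeriv`.
  rw [Matrix.add_mulVec, Matrix.one_mulVec, ← Matrix.mulVec_mulVec,
    eq_neg_of_add_eq_zero_right hy, Matrix.mulVec_neg, Matrix.mulVec_add, Matrix.mulVec_neg,
    Matrix.mulVec_mulVec]
  have h := congrArg (fun P => P.mulVec (y ∘ i)) hM
  simp only [Matrix.add_mulVec, Matrix.zero_mulVec] at h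
  rw [eq_neg_of_add_eq_zero_left h, add_comm]
  rfl

/-- Along the negative gradient flow, the restriction of the diagonal form to the row space has
positive derivative on its null vectors. -/
theorem derivative_pos_of_mem_ker {n m : ℕ} {lam : Fin n → ℝ} (hpos : ∀ j, 0 < lam j)
    {sg : Fin n → ℝ} {d : ℝ} (hd : 0 < d)
    (hsg : ∀ k, (sg k = 1 ∧ d ≤ weight lam k) ∨ (sg k = -1 ∧ weight lam k < d))
    {i : Fin m ↪o Fin n} {Z V : Coord i} (hV : IsGradientAt lam i Z V) {ξ : Fin m → ℝ}
    (hξ : ξ ≠ 0) (hker : (diagForm sg (normalMatrix i Z)).mulVec ξ = 0) :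
    0 < ξ ⬝ᵥ (pad i (-V) * Matrix.diagonal sg * (normalMatrix i Z).transpose
      + normalMatrix i Z * Matrix.diagonal sg * (pad i (-V)).transpose).mulVec ξ := by
  have hf := localFun_pos hpos i Z
  have hH := (diagForm_posDef (weight_pos hpos) i Z).det_pos.ne'
  have hpad := fun y => pad_gradient_mulVec hpos hV (y := y)
  have hinj : ∀ ζ : Fin m → ℝ, Matrix.vecMul ζ (normalMatrix i Z) = 0 → ζ = 0 := by
    intro ζ hζ
    have h1 : Matrix.vecMul ζ ((normalMatrix i Z).submatrix id i) = 0 := by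
      ext a
      exact congrFun hζ (i a)
    rwa [normalMatrix_submatrix, Matrix.vecMul_one] at h1
  rw [logDeriv] at hpad
  generalize normalMatrix i Z = X at *
  obtain ⟨v, hv⟩ : ∃ v, v = Matrix.vecMul ξ X := ⟨_, rfl⟩
  -- With `G` and `H` the unweighted and weighted Gram matrices, `η = H⁻¹Gξ`. Pairing `Hη = Gξ` with
  -- `ξ` and with `η` gives the last two hypotheses of `sum_sign_mul_pos`.
  obtain ⟨η, hη⟩ : ∃ η, η = (diagForm (weight lam) X)⁻¹.mulVec
      ((diagForm (fun _ => 1) X).mulVec ξ) := ⟨_, rfl⟩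
  obtain ⟨w, hw⟩ : ∃ w, w = Matrix.vecMul η X := ⟨_, rfl⟩
  have hform : ∀ (D : Fin n → ℝ) (ζ : Fin m → ℝ), (diagForm D X).mulVec ζ
      = X.mulVec (fun k => D k * Matrix.vecMul ζ X k) := by
    intro D ζ
    rw [diagForm, ← Matrix.mulVec_mulVec, ← Matrix.mulVec_mulVec, Matrix.mulVec_transpose]
    congr 1
    ext k
    rw [Matrix.mulVec_diagonal]
  have hpair : ∀ (D : Fin n → ℝ) (ζ θ : Fin m → ℝ), θ ⬝ᵥ (diagForm D X).mulVec ζ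
      = ∑ k, D k * Matrix.vecMul ζ X k * Matrix.vecMul θ X k := by
    intro D ζ θ
    rw [hform, Matrix.dotProduct_mulVec, dotProduct]
    exact Finset.sum_congr rfl fun k _ => by ring
  have hHη : (diagForm (weight lam) X).mulVec η = (diagForm (fun _ => 1) X).mulVec ξ := by
    rw [hη, Matrix.mulVec_mulVec, Matrix.mul_nonsing_inv _ (isUnit_iff_ne_zero.2 hH),
      Matrix.one_mulVec]
  have k1 := hpair sg ξ ξ
  have k2 := hpair sg ξ η
  have k3 := hpair (weight lam) η ξ
  have k4 := hpair (weight lam) η η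
  rw [hHη, hpair] at k3 k4
  rw [hker, dotProduct_zero] at k1 k2
  rw [← hv] at k1 k2 k3 k4
  rw [← hw] at k2 k3 k4
  have main := sum_sign_mul_pos hd (weight_pos hpos) hsg (v := v) (w := w)
    (fun h => hξ (hinj ξ (hv ▸ h))) (by simpa [pow_two, mul_assoc] using k1.symm) k2.symm
    (by
      rw [Finset.sum_congr rfl fun k _ => show weight lam k * v k * w k
        = weight lam k * w k * v k by ring, ← k3]
      exact Finset.sum_congr rfl fun k _ => by ring)
    (by
      rw [Finset.sum_congr rfl fun k _ => show weight lam k * w k ^ 2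
        = weight lam k * w k * w k by ring, ← k4]
      exact Finset.sum_congr rfl fun k _ => by ring)
  -- Since `ξ` is in the kernel, `sg · v` annihilates the row space, so the gradient formula
  -- applies. It also removes the `G⁻¹X` part of `logDeriv`, leaving only the weighted part.
  obtain ⟨y, hy⟩ : ∃ y : Fin n → ℝ, y = fun k => sg k * v k := ⟨_, rfl⟩
  have hXy : X.mulVec y = 0 := by
    rw [← hker, hform, hy, hv]
  have hsgy : (Matrix.diagonal sg).mulVec v = y := by
    ext k
    rw [Matrix.mulVec_diagonal, hy]
  have hneg : pad i (-V) = -pad i V := by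
    ext a k
    by_cases hk : ∀ b, i b ≠ k <;> simp [pad, hk]
  have hGM : ξ ⬝ᵥ (pad i V).mulVec y
      = -(2 * localFun lam i Z) * ∑ k, sg k * (weight lam k * v k * w k) := by
    rw [hpad y hXy, dotProduct_smul, smul_eq_mul, ← Matrix.mulVec_mulVec, Matrix.sub_mulVec,
      ← Matrix.mulVec_mulVec, hXy, Matrix.mulVec_zero, zero_sub, Matrix.mulVec_neg,
      dotProduct_neg, Matrix.mul_assoc, ← Matrix.mulVec_mulVec, Matrix.dotProduct_mulVec ξ,
      ← Matrix.mulVec_transpose, diagForm_transpose, Matrix.dotProduct_mulVec,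
      ← Matrix.mulVec_transpose, Matrix.transpose_nonsing_inv, diagForm_transpose, ← hη,
      ← Matrix.mulVec_mulVec, Matrix.dotProduct_mulVec, ← hw, dotProduct, mul_neg, neg_mul]
    congr 2
    refine Finset.sum_congr rfl fun k _ => ?_
    rw [Matrix.mulVec_diagonal, hy]
    ring
  have hsym : ξ ⬝ᵥ (X * Matrix.diagonal sg * (pad i (-V)).transpose).mulVec ξ
      = ξ ⬝ᵥ (pad i (-V) * Matrix.diagonal sg * X.transpose).mulVec ξ := by
    rw [Matrix.dotProduct_mulVec, ← Matrix.mulVec_transpose, dotProduct_comm]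
    simp [Matrix.mul_assoc]
  rw [Matrix.add_mulVec, dotProduct_add, hsym, ← Matrix.mulVec_mulVec, Matrix.mulVec_transpose,
    ← hv, ← Matrix.mulVec_mulVec, hsgy, hneg, Matrix.neg_mulVec, dotProduct_neg, hGM]
  have := mul_pos hf main
  linarith

/-! ### Monotonicity of the inertia along trajectories -/

/-- Too few positive directions at `t₀` leave nonpositive ones, and the positive derivative on the
kernel makes these strictly negative just before. -/
theorem eventually_mem_positiveSet_neg {n m : ℕ} {lam : Fin n → ℝ} (hpos : ∀ j, 0 < lam j)
    {sg : Fin n → ℝ} {d : ℝ} (hd : 0 < d)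
    (hsg : ∀ k, (sg k = 1 ∧ d ≤ weight lam k) ∨ (sg k = -1 ∧ weight lam k < d))
    {γ : ℝ → Gr n m} (hγ : IsTrajectory lam γ) {p : ℕ} {t₀ : ℝ}
    (h : γ t₀ ∉ positiveSet sg p) : ∀ᶠ t in 𝓝[<] t₀, γ t ∈ positiveSet (-sg) (m + 1 - p) := by
  obtain ⟨i, hi⟩ := exists_mem_chartDomain (γ t₀)
  obtain ⟨V, hV, hder⟩ := hγ.2 t₀ i hi
  have hev : ∀ᶠ t in 𝓝[<] t₀, γ t ∈ chartDomain i :=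
    nhdsWithin_le_nhds (hγ.1.continuousAt.eventually_mem ((isOpen_chartDomain i).mem_nhds hi))
  have hmem : ∀ (sg' : Fin n → ℝ) (q : ℕ) (t : ℝ), γ t ∈ chartDomain i →
      (γ t ∈ positiveSet sg' q ↔ HasPositive sg' q (normalMatrix i (chart i (γ t)))) := by
    intro sg' q t ht
    nth_rw 1 [← chartInv_chart i ht]
    exact proj_mem_positiveSet _ _ _
  have key := eventually_negative_directions
    (S := fun t => diagForm sg (normalMatrix i (chart i (γ t)))) (t₀ := t₀)
    (diagForm_transpose _ _) (hasDerivAt_diagForm sg (hasDerivAt_normalMatrix i hder))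
    (fun ξ hξ hker => derivative_pos_of_mem_ker hpos hd hsg hV hξ hker) p (by
      rintro ⟨B, hB⟩
      refine h ((hmem sg p t₀ hi).2 ⟨B, fun c hc => ?_⟩)
      rw [diagForm_mul, ← quadratic_vecMul]
      exact hB c hc)
  filter_upwards [key, hev] with t ht hti
  obtain ⟨C, hC⟩ := ht
  refine (hmem _ _ t hti).2 ⟨C, fun c hc => ?_⟩
  have := hC c hc
  rw [diagForm_mul, ← quadratic_vecMul, diagForm_neg, Matrix.neg_mulVec, dotProduct_neg]
  linarith

theorem mem_positiveSet_of_le {n m : ℕ} {lam : Fin n → ℝ} (hpos : ∀ j, 0 < lam j)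
    {sg : Fin n → ℝ} {d : ℝ} (hd : 0 < d)
    (hsg : ∀ k, (sg k = 1 ∧ d ≤ weight lam k) ∨ (sg k = -1 ∧ weight lam k < d))
    {γ : ℝ → Gr n m} (hγ : IsTrajectory lam γ) {p : ℕ} {a b : ℝ} (hab : a ≤ b)
    (ha : γ a ∈ positiveSet sg p) : γ b ∈ positiveSet sg p := by
  by_contra hb
  -- Time is reversed because the continuation principle on intervals moves to the right. Failure of
  -- positivity is closed and persists slightly further into the past, since `p + (m + 1 - p)`
  -- exceeds `m`; hence it would reach back to `a`.
  have hclosed : IsClosed {t : ℝ | γ (-t) ∉ positiveSet sg p} :=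
    ((isOpen_positiveSet sg p).preimage (hγ.1.comp continuous_neg)).isClosed_compl
  have key := (hclosed.inter isClosed_Icc).Icc_subset_of_forall_mem_nhdsWithin (a := -b) (b := -a)
    (by simpa using hb) (fun x hx => by
      have h1 := tendsto_neg_nhdsGT (a := x) |>.eventually
        (eventually_mem_positiveSet_neg hpos hd hsg hγ hx.1)
      filter_upwards [h1] with t ht hcon
      have := add_le_of_mem_positiveSet hcon ht
      omega)
  have h2 := key (Set.right_mem_Icc.2 (neg_le_neg hab))
  simp only [Set.mem_ofPred_eq, neg_neg] at h2
  exact h2 ha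

/-- A critical point reached from `O_i` by negative gradient trajectories has smaller indices. -/
theorem le_of_mem_unstable_of_mem_stable {n m : ℕ} {lam : Fin n → ℝ} (hpos : ∀ j, 0 < lam j)
    (hmono : StrictMono lam) {i l : Fin m ↪o Fin n} {x : Gr n m}
    (hi : x ∈ unstableManifold lam (origin i)) (hl : x ∈ stableManifold lam (origin l))
    (k : Fin m) : l k ≤ i k := by
  by_contra hlt
  push Not at hlt
  -- The weights `λ⁻²` decrease with the index, so this sign pattern is the threshold condition with
  -- `d = weight lam (i k)`.
  obtain ⟨sg, hsgdef⟩ : ∃ sg : Fin n → ℝ, sg = fun j => if j ≤ i k then 1 else -1 := ⟨_, rfl⟩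
  have hsg : ∀ j, (sg j = 1 ∧ weight lam (i k) ≤ weight lam j) ∨
      (sg j = -1 ∧ weight lam j < weight lam (i k)) := by
    intro j
    rcases le_or_gt j (i k) with h | h
    · left
      refine ⟨by simp [hsgdef, h], ?_⟩
      exact inv_anti₀ (pow_pos (hpos j) 2)
        (pow_le_pow_left₀ (hpos j).le (hmono.monotone h) 2)
    · right
      refine ⟨by simp [hsgdef, h], ?_⟩
      exact inv_strictAnti₀ (pow_pos (hpos _) 2)
        (pow_lt_pow_left₀ (hmono h) (hpos _).le two_ne_zero)
  have hd := weight_pos hpos (i k)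
  obtain ⟨γ₁, hγ₁, hx₁, ht₁⟩ := hi
  obtain ⟨γ₂, hγ₂, hx₂, ht₂⟩ := hl
  have h1 : origin i ∈ positiveSet sg ((k : ℕ) + 1) :=
    origin_mem_positiveSet i (Fin.castLEEmb k.2) (fun c => by
      have : i (Fin.castLEEmb k.2 c) ≤ i k := i.monotone (Nat.lt_succ_iff.1 c.2)
      simp only [hsgdef, if_pos this, zero_lt_one])
  have h2 : origin l ∈ positiveSet (-sg) (m - k) :=
    origin_mem_positiveSet l
      ⟨fun c => ⟨k + c, by have := c.2; omega⟩, fun c c' h => by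
        simpa [Fin.ext_iff] using h⟩ (fun c => by
      have : l k ≤ l ⟨k + c, by have := c.2; omega⟩ :=
        l.monotone (show (k : ℕ) ≤ k + c from Nat.le_add_right _ _)
      have h3 := not_le.2 (hlt.trans_le this)
      rw [Pi.neg_apply, hsgdef]
      exact neg_pos.2 ((if_neg h3).trans_lt neg_one_lt_zero))
  obtain ⟨a, ha, ha0⟩ := ((ht₁.eventually_mem ((isOpen_positiveSet _ _).mem_nhds h1)).and
    (eventually_le_atBot (0 : ℝ))).exists
  obtain ⟨b, hb, hb0⟩ := ((ht₂.eventually_mem ((isOpen_positiveSet _ _).mem_nhds h2)).and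
    (eventually_ge_atTop (0 : ℝ))).exists
  -- Monotonicity is used on each trajectory separately, up to and from their common point `x`, so
  -- uniqueness of solutions is not needed.
  have h0 := mem_positiveSet_of_le hpos hd hsg hγ₁ ha0 ha
  rw [hx₁, ← hx₂] at h0
  have := add_le_of_mem_positiveSet (mem_positiveSet_of_le hpos hd hsg hγ₂ hb0 h0) hb
  have := k.2
  omega

/-! ### The Morse index -/

/-- A column of the origin's matrix outside `i` is zero, so only its own chart contains it. The
quantifier over charts in `morseIndex` thus collapses, with no change of coordinates for the
Hessian. -/
theorem eq_of_origin_mem_chartDomain {n m : ℕ} {i j : Fin m ↪o Fin n}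
    (h : origin i ∈ chartDomain j) : j = i := by
  have hdet := (proj_mem_chartDomain j _).1 h
  have hg : ∀ b, ∃ a, i a = j b := by
    intro b
    by_contra hcon
    push Not at hcon
    refine hdet (Matrix.det_eq_zero_of_column_eq_zero b fun a => ?_)
    simp [normalMatrix, hcon]
  choose g hg using hg
  have hginj : Function.Injective g := fun b b' hb => by
    have := hg b
    rw [hb, hg b'] at this
    exact (j.injective this).symm
  have hgsurj := Finite.surjective_of_injective hginj
  have hrange : Set.range j = Set.range i := by
    rw [← funext hg]
    exact hgsurj.range_comp i
  exact DFunLike.coe_injective ((j.strictMono.range_inj i.strictMono).1 hrange)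

/-- Continuity of `h` suffices, so the Hessian along a ray is read off from the first differential
without differentiating the inverse matrices. -/
theorem hasDerivAt_id_mul {h : ℝ → ℝ} (hc : ContinuousAt h 0) :
    HasDerivAt (fun t => t * h t) (h 0) 0 := by
  rw [hasDerivAt_iff_tendsto_slope]
  refine (hc.tendsto.mono_left nhdsWithin_le_nhds).congr' ?_
  filter_upwards [self_mem_nhdsWithin] with t ht
  have ht' : t ≠ 0 := ht
  rw [slope_def_field]
  field_simp
  ring

theorem normalMatrix_smul {n m : ℕ} (i : Fin m ↪o Fin n) (t : ℝ) (V : Coord i) :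
    normalMatrix i (t • V) = normalMatrix i 0 + t • pad i V := by
  ext a k
  by_cases hk : ∀ b, i b ≠ k <;> simp [normalMatrix, pad, hk]

/-- The origin's matrix and `pad i V` have disjoint column supports, which a diagonal matrix does
not mix; only the part linear in `t` survives. -/
theorem trace_mul_pad {n m : ℕ} (i : Fin m ↪o Fin n) (A : Matrix (Fin m) (Fin m) ℝ)
    (D : Fin n → ℝ) (t : ℝ) (V : Coord i) :
    (A * normalMatrix i (t • V) * Matrix.diagonal D * (pad i V).transpose).trace
      = t * (A * (pad i V * Matrix.diagonal D * (pad i V).transpose)).trace := by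
  have h0 : normalMatrix i 0 * (Matrix.diagonal D * (pad i V).transpose) = 0 := by
    ext a b
    rw [Matrix.mul_apply]
    refine Finset.sum_eq_zero fun k _ => ?_
    rw [Matrix.diagonal_mul, Matrix.transpose_apply]
    by_cases hk : ∀ b, i b ≠ k
    · simp [normalMatrix, hk]
    · simp [pad, hk]
  rw [normalMatrix_smul, Matrix.mul_assoc, Matrix.mul_assoc, Matrix.add_mul, h0, zero_add,
    Matrix.smul_mul, Matrix.mul_smul, Matrix.trace_smul, smul_eq_mul, Matrix.mul_assoc]

theorem continuous_trace_inv_mul {n m : ℕ} {D : Fin n → ℝ} (hD : ∀ k, 0 < D k)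
    (i : Fin m ↪o Fin n) (V : Coord i) (A : Matrix (Fin m) (Fin m) ℝ) :
    Continuous (fun t : ℝ => ((diagForm D (normalMatrix i (t • V)))⁻¹ * A).trace) := by
  have hc : Continuous (fun t : ℝ => diagForm D (normalMatrix i (t • V))) := by
    simp only [normalMatrix_smul, diagForm]
    fun_prop
  have hd : ∀ t : ℝ, (diagForm D (normalMatrix i (t • V))).det ≠ 0 := fun t =>
    (diagForm_posDef hD i _).det_pos.ne'
  simp only [Matrix.inv_def, Ring.inverse_eq_inv']
  exact ((((hc.matrix_det).inv₀ hd).smul hc.matrix_adjugate).matrix_mul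
    continuous_const).matrix_trace

/-- The factor by which the differential of `f` along a ray from the origin of a chart
is divisible by the parameter. -/
def rayFactor {n m : ℕ} (lam : Fin n → ℝ) (i : Fin m ↪o Fin n) (V : Coord i) (t : ℝ) : ℝ :=
  2 * localFun lam i (t • V) *
    (((diagForm (fun _ => 1) (normalMatrix i (t • V)))⁻¹
        * (pad i V * Matrix.diagonal (fun _ : Fin n => (1 : ℝ)) * (pad i V).transpose)).trace
      - ((diagForm (weight lam) (normalMatrix i (t • V)))⁻¹
        * (pad i V * Matrix.diagonal (weight lam) * (pad i V).transpose)).trace)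

theorem fderiv_localFun_ray {n m : ℕ} {lam : Fin n → ℝ} (hpos : ∀ j, 0 < lam j)
    (i : Fin m ↪o Fin n) (V : Coord i) (t : ℝ) :
    fderiv ℝ (localFun lam i) (t • V) V = t * rayFactor lam i V t := by
  have h3 : Matrix.diagonal (fun _ : Fin n => (1 : ℝ)) = 1 := Matrix.diagonal_one
  have h1 := trace_mul_pad i (diagForm (fun _ => 1) (normalMatrix i (t • V)))⁻¹
    (fun _ => 1) t V
  rw [h3, Matrix.mul_one, Matrix.mul_one] at h1
  rw [fderiv_localFun hpos, logDeriv, Matrix.sub_mul, Matrix.trace_sub, trace_mul_pad, h1,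
    rayFactor, h3, Matrix.mul_one]
  ring

theorem continuous_rayFactor {n m : ℕ} {lam : Fin n → ℝ} (hpos : ∀ j, 0 < lam j)
    (i : Fin m ↪o Fin n) (V : Coord i) : Continuous (rayFactor lam i V) := by
  have hf : Continuous (fun t : ℝ => localFun lam i (t • V)) :=
    (contDiff_localFun hpos i (r := 0)).continuous.comp (continuous_id.smul continuous_const)
  exact (continuous_const.mul hf).mul ((continuous_trace_inv_mul (fun _ => one_pos) i V _).sub
    (continuous_trace_inv_mul (weight_pos hpos) i V _))

theorem trace_inv_origin {n m : ℕ} {D : Fin n → ℝ} (hD : ∀ k, 0 < D k)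
    (i : Fin m ↪o Fin n) (V : Coord i) : ((diagForm D (normalMatrix i 0))⁻¹
      * (pad i V * Matrix.diagonal D * (pad i V).transpose)).trace
        = ∑ a, ∑ k : Rest i, D k.1 / D (i a) * V a k ^ 2 := by
  have hentry : ∀ a : Fin m, (pad i V * Matrix.diagonal D * (pad i V).transpose) a a
      = ∑ k : Rest i, D k.1 * V a k ^ 2 := by
    intro a
    rw [Matrix.mul_apply, sum_split i]
    simp only [Matrix.mul_diagonal, Matrix.transpose_apply, pad_apply_range, pad_apply_rest]
    simp only [zero_mul, Finset.sum_const_zero, zero_add]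
    exact Finset.sum_congr rfl fun k _ => by ring
  rw [diagForm_normalMatrix_zero, Matrix.inv_diagonal, Matrix.trace]
  refine Finset.sum_congr rfl fun a _ => ?_
  rw [Matrix.diag_apply, Matrix.diagonal_mul, hentry, Finset.mul_sum]
  have hu : IsUnit (fun a => D (i a)) :=
    Pi.isUnit_iff.2 fun a => isUnit_iff_ne_zero.2 (hD _).ne'
  have hr : Ring.inverse (fun a => D (i a)) a = (D (i a))⁻¹ := by
    have := congrFun (Ring.inverse_mul_cancel _ hu) a
    exact eq_inv_of_mul_eq_one_left this
  rw [hr]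
  exact Finset.sum_congr rfl fun k _ => by ring

theorem localHessian_eq_rayFactor {n m : ℕ} {lam : Fin n → ℝ} (hpos : ∀ j, 0 < lam j)
    (i : Fin m ↪o Fin n) (V : Coord i) : localHessian lam i 0 V V = rayFactor lam i V 0 := by
  have hline : HasDerivAt (fun t : ℝ => t • V) V 0 := by
    simpa using (hasDerivAt_id (0 : ℝ)).smul_const V
  have hdiff : HasFDerivAt (fderiv ℝ (localFun lam i)) (fderiv ℝ (fderiv ℝ (localFun lam i)) 0)
      ((fun t : ℝ => t • V) 0) := by
    simp only [zero_smul]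
    exact (((contDiff_localFun hpos i (r := 2)).fderiv_right (m := 1) le_rfl).differentiable
      one_ne_zero 0).hasFDerivAt
  have hsecond := ((ContinuousLinearMap.apply ℝ ℝ V).hasFDerivAt.comp _ hdiff).comp_hasDerivAt
    0 hline
  have h4 : HasDerivAt (fun t : ℝ => fderiv ℝ (localFun lam i) (t • V) V)
      (rayFactor lam i V 0) 0 := by
    rw [funext (fderiv_localFun_ray hpos i V)]
    exact hasDerivAt_id_mul (continuous_rayFactor hpos i V).continuousAt
  exact hsecond.unique h4

theorem localHessian_origin {n m : ℕ} {lam : Fin n → ℝ} (hpos : ∀ j, 0 < lam j)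
    (i : Fin m ↪o Fin n) (V : Coord i) : localHessian lam i 0 V V = 2 * localFun lam i 0 *
      ∑ a, ∑ k : Rest i, (1 - weight lam k.1 / weight lam (i a)) * V a k ^ 2 := by
  rw [localHessian_eq_rayFactor hpos, rayFactor]
  simp only [zero_smul]
  rw [trace_inv_origin (fun _ => one_pos), trace_inv_origin (weight_pos hpos),
    ← Finset.sum_sub_distrib]
  congr 1
  refine Finset.sum_congr rfl fun a _ => ?_
  rw [← Finset.sum_sub_distrib]
  exact Finset.sum_congr rfl fun k _ => by ring

/-- The maximal dimension of a negative definite subspace for a diagonal quadratic form. -/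
theorem isGreatest_finrank_negative {α β : Type*} [Fintype α] [Fintype β] (c : α → β → ℝ) :
    IsGreatest {d | ∃ S : Submodule ℝ (α → β → ℝ), Module.finrank ℝ S = d ∧
      ∀ V ∈ S, V ≠ 0 → ∑ a, ∑ b, c a b * V a b ^ 2 < 0}
      (Nat.card {x : α × β // c x.1 x.2 < 0}) := by
  classical
  constructor
  · let φ : ({x : α × β // c x.1 x.2 < 0} → ℝ) →ₗ[ℝ] (α → β → ℝ) :=
      { toFun := fun v a b => if h : c a b < 0 then v ⟨(a, b), h⟩ else 0
        map_add' := fun v w => by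
          funext a b
          by_cases h : c a b < 0 <;> simp [h]
        map_smul' := fun r v => by
          funext a b
          by_cases h : c a b < 0 <;> simp [h] }
    have hφ : ∀ v a b, φ v a b = if h : c a b < 0 then v ⟨(a, b), h⟩ else 0 :=
      fun _ _ _ => rfl
    have hinj : Function.Injective φ := by
      intro v w h
      funext x
      have := congrFun (congrFun h x.1.1) x.1.2
      simpa [hφ, x.2] using this
    refine ⟨LinearMap.range φ, ?_, ?_⟩
    · rw [LinearMap.finrank_range_of_inj hinj, Module.finrank_fintype_fun_eq_card,
        Nat.card_eq_fintype_card]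
    · rintro _ ⟨v, rfl⟩ hv
      have hle : ∀ a b, c a b * φ v a b ^ 2 ≤ 0 := by
        intro a b
        rw [hφ]
        split_ifs with h
        · exact mul_nonpos_of_nonpos_of_nonneg h.le (sq_nonneg _)
        · simp
      obtain ⟨a, ha⟩ := Function.ne_iff.1 hv
      obtain ⟨b, hb⟩ := Function.ne_iff.1 ha
      have hlt : c a b * φ v a b ^ 2 < 0 := by
        have hb' : φ v a b ≠ 0 := hb
        have hc : c a b < 0 := by
          by_contra hc
          exact hb' (by rw [hφ, dif_neg hc])
        exact mul_neg_of_neg_of_pos hc (by positivity)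
      exact Finset.sum_neg' (fun a _ => Finset.sum_nonpos fun b _ => hle a b)
        ⟨a, Finset.mem_univ _, Finset.sum_neg' (fun b _ => hle a b) ⟨b, Finset.mem_univ _, hlt⟩⟩
  · rintro d ⟨S, rfl, hS⟩
    -- Forgetting the coordinates with nonnegative coefficient is injective on a negative definite
    -- subspace: on the kernel of `ρ` the form is nonnegative.
    let ρ : (α → β → ℝ) →ₗ[ℝ] ({x : α × β // c x.1 x.2 < 0} → ℝ) :=
      { toFun := fun V x => V x.1.1 x.1.2
        map_add' := fun _ _ => rfl
        map_smul' := fun _ _ => rfl }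
    have hinj : Function.Injective (ρ.comp S.subtype) := by
      rw [← LinearMap.ker_eq_bot, LinearMap.ker_eq_bot']
      intro V hV
      by_contra hne
      refine (hS V V.2 fun h => hne (Subtype.ext h)).not_ge ?_
      refine Finset.sum_nonneg fun a _ => Finset.sum_nonneg fun b _ => ?_
      by_cases h : c a b < 0
      · have h1 : (V : α → β → ℝ) a b = 0 := congrFun hV ⟨(a, b), h⟩
        simp [h1]
      · exact mul_nonneg (not_lt.1 h) (sq_nonneg _)
    have := LinearMap.finrank_le_finrank_of_injective hinj
    rwa [Module.finrank_fintype_fun_eq_card, ← Nat.card_eq_fintype_card] at this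

/-- Counting from zero, exactly `i a` indices lie below `i a`, and `a` of them are among the chosen
ones. -/
theorem card_rest_lt {n m : ℕ} (i : Fin m ↪o Fin n) (a : Fin m) :
    (Nat.card {k : Rest i // k.1 < i a}) + a = i a := by
  have h := sum_split i (fun k => if k < i a then 1 else 0)
  simp only [i.lt_iff_lt, ← Finset.card_filter] at h
  rw [Nat.card_eq_fintype_card, Fintype.card_subtype]
  have h1 : (Finset.univ.filter fun k : Fin n => k < i a).card = i a := by
    rw [Finset.filter_gt_eq_Iio, Fin.card_Iio]
  have h2 : (Finset.univ.filter fun k : Fin m => k < a).card = a := by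
    rw [Finset.filter_gt_eq_Iio, Fin.card_Iio]
  omega

theorem morseIndex_origin {n m : ℕ} {lam : Fin n → ℝ} (hpos : ∀ j, 0 < lam j)
    (hmono : StrictMono lam) (i : Fin m ↪o Fin n) :
    (morseIndex lam (origin i) : ℤ) = ∑ a, (((i a : ℕ) : ℤ) - ((a : ℕ) : ℤ)) := by
  have hset : {d | ∃ j : Fin m ↪o Fin n, origin i ∈ chartDomain j ∧
      ∃ S : Submodule ℝ (Coord j), Module.finrank ℝ S = d ∧
        ∀ V ∈ S, V ≠ 0 → localHessian lam j (chart j (origin i)) V V < 0}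
      = {d | ∃ S : Submodule ℝ (Coord i), Module.finrank ℝ S = d ∧ ∀ V ∈ S, V ≠ 0 →
        ∑ a, ∑ k : Rest i, (1 - weight lam k.1 / weight lam (i a)) * V a k ^ 2 < 0} := by
    have hiff : ∀ V : Coord i, localHessian lam i (chart i (origin i)) V V < 0 ↔
        ∑ a, ∑ k : Rest i, (1 - weight lam k.1 / weight lam (i a)) * V a k ^ 2 < 0 := by
      intro V
      have hf := localFun_pos hpos i 0
      rw [show chart i (origin i) = 0 from chart_chartInv i 0, localHessian_origin hpos]
      refine ⟨fun h => ?_, mul_neg_of_pos_of_neg (by positivity)⟩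
      by_contra hcon
      exact h.not_ge (mul_nonneg (by positivity) (not_lt.1 hcon))
    ext d
    constructor
    · rintro ⟨j, hj, S, hS, h⟩
      obtain rfl := eq_of_origin_mem_chartDomain hj
      exact ⟨S, hS, fun V hV h0 => (hiff V).1 (h V hV h0)⟩
    · rintro ⟨S, hS, h⟩
      exact ⟨i, chartInv_mem i 0, S, hS, fun V hV h0 => (hiff V).2 (h V hV h0)⟩
  have hlt : ∀ (a : Fin m) (k : Fin n), 1 - weight lam k / weight lam (i a) < 0 ↔ k < i a := by
    intro a k
    rw [sub_neg, one_lt_div (weight_pos hpos _), weight, weight,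
      inv_lt_inv₀ (pow_pos (hpos _) 2) (pow_pos (hpos _) 2),
      pow_lt_pow_iff_left₀ (hpos _).le (hpos _).le two_ne_zero, hmono.lt_iff_lt]
  rw [morseIndex, hset, (isGreatest_finrank_negative _).csSup_eq]
  simp only [hlt]
  have hcard : Nat.card {x : Fin m × Rest i // x.2.1 < i x.1}
      = ∑ a, Nat.card {k : Rest i // k.1 < i a} := by
    rw [← Nat.card_sigma]
    exact Nat.card_congr (Equiv.subtypeProdEquivSigmaSubtype fun a (k : Rest i) => k.1 < i a)
  rw [hcard, Nat.cast_sum]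
  refine Finset.sum_congr rfl fun a _ => ?_
  have := card_rest_lt i a
  omega

end RealGrassmann

end

/-! ### Conclusion: comparing the index sums. -/

theorem theorem1 {n m : ℕ} (lam : Fin n → ℝ) (hpos : ∀ j, 0 < lam j) (hmono : StrictMono lam)
    (i l : Fin m ↪o Fin n)
    (hind : (RealGrassmann.morseIndex lam (RealGrassmann.origin i) : ℤ)
      - (RealGrassmann.morseIndex lam (RealGrassmann.origin l) : ℤ) = 1)
    (hgap : ∃ k : Fin m, ((i k : ℕ) : ℤ) - ((l k : ℕ) : ℤ) > 1) :
    RealGrassmann.unstableManifold lam (RealGrassmann.origin i)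
        ∩ RealGrassmann.stableManifold lam (RealGrassmann.origin l) = ∅ ∧
      ¬ ∃ γ : ℝ → RealGrassmann.Gr n m, RealGrassmann.IsTrajectory lam γ ∧
        Tendsto γ atBot (𝓝 (RealGrassmann.origin i)) ∧
        Tendsto γ atTop (𝓝 (RealGrassmann.origin l)) := by
  have hempty : RealGrassmann.unstableManifold lam (RealGrassmann.origin i)
      ∩ RealGrassmann.stableManifold lam (RealGrassmann.origin l) = ∅ := by
    refine Set.eq_empty_iff_forall_notMem.2 ?_
    rintro x ⟨hi, hl⟩
    have hle := RealGrassmann.le_of_mem_unstable_of_mem_stable hpos hmono hi hl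
    rw [RealGrassmann.morseIndex_origin hpos hmono, RealGrassmann.morseIndex_origin hpos hmono,
      ← Finset.sum_sub_distrib] at hind
    obtain ⟨k, hk⟩ := hgap
    -- The terms `i a - l a` are nonnegative by `hle` and sum to one, so the single term at `k` is
    -- at most one, against `hk`.
    have hsingle := Finset.single_le_sum
      (f := fun a : Fin m => (((i a : ℕ) : ℤ) - ((a : ℕ) : ℤ)) - (((l a : ℕ) : ℤ) - ((a : ℕ) : ℤ)))
      (fun a _ => by
        have : (l a : ℕ) ≤ i a := hle a
        omega) (Finset.mem_univ k)
    simp only [hind] at hsingle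
    omega
  refine ⟨hempty, ?_⟩
  rintro ⟨γ, hγ, hbot, htop⟩
  have hmem : γ 0 ∈ RealGrassmann.unstableManifold lam (RealGrassmann.origin i)
      ∩ RealGrassmann.stableManifold lam (RealGrassmann.origin l) :=
    ⟨⟨γ, hγ, rfl, hbot⟩, ⟨γ, hγ, rfl, htop⟩⟩
  rw [hempty] at hmem
  exact hmem
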